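/- Let $n\ge 0$ and let $\mathfrak S_n$ be the set of permutations of $[n]=\{1,\dots,n\}$. *Cyclic statistics.* For $\sigma\in\mathfrak S_n$ let $\mathrm{drop}\,\sigma=\#\{i:\ i>\sigma(i)\}$, and call $x\in[n]$ a *cyclic valley* if $\sigma^{-1}(x)>x<\sigma(x)$, a *(cyclic) double excedance* if $\sigma^{-1}(x)<x<\sigma(x)$, a *(cyclic) double drop* if $\sigma^{-1}(x)>x>\sigma(x)$, and a *fixed point* if $\sigma(x)=x$; let $\mathrm{cvalley}\,\sigma,\ \mathrm{cda}\,\sigma,\ \mathrm{cdd}\,\sigma,\ \mathrm{fix}\,\sigma$ be their numbers. Let $\mathrm{cros}\,\sigma$ be the number of $(i,j)\in[n]^2$ with $i<j\le\sigma(i)<\sigma(j)$ or $i>j>\sigma(i)>\sigma(j)$, and $\mathrm{nest}\,\sigma$ the number of $(i,j)\in[n]^2$ with $i<j\le\sigma(j)<\sigma(i)$ or $i>j>\sigma(j)>\sigma(i)$. *Linear statistics.* With the convention $\sigma(0)=0$, $\sigma(n+1)=n+1$, the entry $\sigma(i)$ $(i\in[n])$ is a *valley* if $\sigma(i-1)>\sigma(i)<\sigma(i+1)$,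 and a *double ascent* if $\sigma(i-1)<\sigma(i)<\sigma(i+1)$; a double ascent $\sigma(i)$ is a *foremaximum* if $\sigma(j)<\sigma(i)$ for all $1\le j<i$. Let $(31\text{-}2)\sigma$ be the number of pairs $2\le i<j\le n$ with $\sigma(i-1)>\sigma(j)>\sigma(i)$, and $(2\text{-}31)\sigma$ the number of pairs $1\le i<j\le n-1$ with $\sigma(j+1)<\sigma(i)<\sigma(j)$. Let $$B_n(p,q,t,u,v,w,y)=\sum_{\sigma\in\mathfrak S_n}p^{\mathrm{nest}\,\sigma}q^{\mathrm{cros}\,\sigma}t^{\mathrm{drop}\,\sigma}u^{\mathrm{cda}\,\sigma}v^{\mathrm{cdd}\,\sigma}w^{\mathrm{cvalley}\,\sigma}y^{\mathrm{fix}\,\sigma},$$ and define $b_{n,k,j}(p,q)\in\mathbb Z[p,q]$ as the coefficient of $w^ky^j$ in $B_n(p,q,1,0,1,w,y)$. Then for all $n,k,j\ge0$ $$b_{n,k,j}(p,q)=\sum_{\sigma\in\mathfrak S_{n,k,j}}p^{\mathrm{nest}\,\sigma}q^{\mathrm{cros}\,\sigma}=\sum_{\sigma\in\mathfrak S^*_{n,k,j}}p^{(2\text{-}31)\sigma}q^{(31\text{-}2)\sigma},$$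 where $\mathfrak S_{n,k,j}$ is the set of $\sigma\in\mathfrak S_n$ with exactly $k$ cyclic valleys, exactly $j$ fixed points and no double excedance, and $\mathfrak S^*_{n,k,j}$ is the set of $\sigma\in\mathfrak S_n$ with exactly $k$ valleys and exactly $j$ double ascents, all of which are foremaxima. In particular, $$b_{n,k,0}(p,q)=\sum_{\sigma\in\mathfrak D_{n,k,0}}p^{\mathrm{nest}\,\sigma}q^{\mathrm{cros}\,\sigma}=\sum_{\sigma\in\mathfrak D^*_{n,k,0}}p^{(2\text{-}31)\sigma}q^{(31\text{-}2)\sigma},$$ where $\mathfrak D_{n,k,0}$ is the set of derangements of $[n]$ with exactly $k$ cyclic valleys and no double excedance, and $\mathfrak D^*_{n,k,0}$ is the set of coderangements of $[n]$ (permutations without foremaximum) with exactly $k$ valleys and no double ascent. -/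

import Mathlib

namespace PermStat

open Finset

/-! Permutations of `[n]` are elements of `Equiv.Perm (Fin n)`; the letter `i ∈ [n]` is the
element of `Fin n` with value `i - 1`. The cyclic statistics only compare letters, so they are
stated directly on `Fin n`. The linear statistics use the word `σ(0) σ(1) … σ(n) σ(n+1)`
with one-based positions and letters. -/

section Cyclic

variable {n : ℕ}

/-- The number of drops: `i` with `i > σ(i)`. -/
def drops (σ : Equiv.Perm (Fin n)) : ℕ := #{i : Fin n | σ i < i}

/-- The number of cyclic valleys: `x` with `σ⁻¹(x) > x` and `x < σ(x)`. -/
def cvalley (σ : Equiv.Perm (Fin n)) : ℕ := #{x : Fin n | x < σ⁻¹ x ∧ x < σ x}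

/-- The number of (cyclic) double excedances: `x` with `σ⁻¹(x) < x` and `x < σ(x)`. -/
def cda (σ : Equiv.Perm (Fin n)) : ℕ := #{x : Fin n | σ⁻¹ x < x ∧ x < σ x}

/-- The number of (cyclic) double drops: `x` with `σ⁻¹(x) > x` and `x > σ(x)`. -/
def cdd (σ : Equiv.Perm (Fin n)) : ℕ := #{x : Fin n | x < σ⁻¹ x ∧ σ x < x}

/-- The number of fixed points. -/
def fix (σ : Equiv.Perm (Fin n)) : ℕ := #{x : Fin n | σ x = x}

/-- The number of crossings. -/
def cros (σ : Equiv.Perm (Fin n)) : ℕ :=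
  #{ij : Fin n × Fin n |
    (ij.1 < ij.2 ∧ ij.2 ≤ σ ij.1 ∧ σ ij.1 < σ ij.2) ∨
    (ij.1 > ij.2 ∧ ij.2 > σ ij.1 ∧ σ ij.1 > σ ij.2)}

/-- The number of nestings. -/
def nest (σ : Equiv.Perm (Fin n)) : ℕ :=
  #{ij : Fin n × Fin n |
    (ij.1 < ij.2 ∧ ij.2 ≤ σ ij.2 ∧ σ ij.2 < σ ij.1) ∨
    (ij.1 > ij.2 ∧ ij.2 > σ ij.2 ∧ σ ij.2 > σ ij.1)}

end Cyclic

section Linear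

variable {n : ℕ}

/-- The one-based word of `σ`: `word σ i = σ(i) ∈ {1, …, n}` for `1 ≤ i ≤ n`, with the boundary
convention `σ(0) = 0` and `σ(n+1) = n+1` (arguments beyond `n + 1` are never used). -/
def word (σ : Equiv.Perm (Fin n)) (i : ℕ) : ℕ :=
  if h : 1 ≤ i ∧ i ≤ n then (σ ⟨i - 1, by omega⟩ : ℕ) + 1 else i

/-- The entry at position `i` is a valley: `σ(i-1) > σ(i) < σ(i+1)`. -/
def IsValley (σ : Equiv.Perm (Fin n)) (i : ℕ) : Prop :=
  word σ (i - 1) > word σ i ∧ word σ i < word σ (i + 1)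

instance (σ : Equiv.Perm (Fin n)) : DecidablePred (IsValley σ) :=
  fun i => by unfold IsValley; infer_instance

/-- The entry at position `i` is a double ascent: `σ(i-1) < σ(i) < σ(i+1)`. -/
def IsDoubleAscent (σ : Equiv.Perm (Fin n)) (i : ℕ) : Prop :=
  word σ (i - 1) < word σ i ∧ word σ i < word σ (i + 1)

instance (σ : Equiv.Perm (Fin n)) : DecidablePred (IsDoubleAscent σ) :=
  fun i => by unfold IsDoubleAscent; infer_instance

/-- The entry at position `i` is a foremaximum: a double ascent that is a left-to-right
maximum. -/
def IsForemax (σ : Equiv.Perm (Fin n)) (i : ℕ) : Prop :=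
  IsDoubleAscent σ i ∧ ∀ j ∈ Ico 1 i, word σ j < word σ i

instance (σ : Equiv.Perm (Fin n)) : DecidablePred (IsForemax σ) :=
  fun i => by unfold IsForemax; infer_instance

/-- The number of valleys. -/
def valley (σ : Equiv.Perm (Fin n)) : ℕ := #{i ∈ Icc 1 n | IsValley σ i}

/-- The number of double ascents. -/
def da (σ : Equiv.Perm (Fin n)) : ℕ := #{i ∈ Icc 1 n | IsDoubleAscent σ i}

/-- The number of foremaxima. -/
def fmax (σ : Equiv.Perm (Fin n)) : ℕ := #{i ∈ Icc 1 n | IsForemax σ i}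

/-- The statistic (31-2): the number of pairs `2 ≤ i < j ≤ n` with `σ(i-1) > σ(j) > σ(i)`. -/
def pat31_2 (σ : Equiv.Perm (Fin n)) : ℕ :=
  #{ij ∈ Icc 1 n ×ˢ Icc 1 n |
    (2 ≤ ij.1 ∧ ij.1 < ij.2) ∧
    word σ (ij.1 - 1) > word σ ij.2 ∧ word σ ij.2 > word σ ij.1}

/-- The statistic (2-31): the number of pairs `1 ≤ i < j ≤ n - 1` with
`σ(j+1) < σ(i) < σ(j)`. -/
def pat2_31 (σ : Equiv.Perm (Fin n)) : ℕ :=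
  #{ij ∈ Icc 1 n ×ˢ Icc 1 n |
    (ij.1 < ij.2 ∧ ij.2 < n) ∧
    word σ (ij.2 + 1) < word σ ij.1 ∧ word σ ij.1 < word σ ij.2}

end Linear

/-- The polynomial `B_n(p,q,t,u,v,w,y)`, evaluated at elements of a commutative semiring. -/
def B {R : Type*} [CommSemiring R] (n : ℕ) (p q t u v w y : R) : R :=
  ∑ σ : Equiv.Perm (Fin n),
    p ^ nest σ * q ^ cros σ * t ^ drops σ * u ^ cda σ * v ^ cdd σ * w ^ cvalley σ * y ^ fix σ

/-- The variable `p` of `ℤ[p,q]`. -/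
noncomputable def pVar : MvPolynomial (Fin 2) ℤ := MvPolynomial.X 0

/-- The variable `q` of `ℤ[p,q]`. -/
noncomputable def qVar : MvPolynomial (Fin 2) ℤ := MvPolynomial.X 1

/-- `b_{n,k,j}(p,q) ∈ ℤ[p,q]`: the coefficient of `w^k y^j` in `B_n(p,q,1,0,1,w,y)`, which is
viewed as an element of `ℤ[p,q][w][y]`. -/
noncomputable def b (n k j : ℕ) : MvPolynomial (Fin 2) ℤ :=
  ((B n (Polynomial.C (Polynomial.C pVar)) (Polynomial.C (Polynomial.C qVar)) 1 0 1
      (Polynomial.C Polynomial.X) Polynomial.X :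
    Polynomial (Polynomial (MvPolynomial (Fin 2) ℤ))).coeff j).coeff k

/-- Permutations of `[n]` with exactly `k` cyclic valleys, exactly `j` fixed points and no
double excedance. -/
def S (n k j : ℕ) : Finset (Equiv.Perm (Fin n)) :=
  {σ | cvalley σ = k ∧ fix σ = j ∧ cda σ = 0}

/-- Permutations of `[n]` with exactly `k` valleys and exactly `j` double ascents, all of which
are foremaxima. -/
def SStar (n k j : ℕ) : Finset (Equiv.Perm (Fin n)) :=
  {σ | valley σ = k ∧ da σ = j ∧ ∀ i ∈ {i ∈ Icc 1 n | IsDoubleAscent σ i}, IsForemax σ i}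

/-- Derangements of `[n]` with exactly `k` cyclic valleys and no double excedance. -/
def D (n k : ℕ) : Finset (Equiv.Perm (Fin n)) :=
  {σ | (∀ x, σ x ≠ x) ∧ cvalley σ = k ∧ cda σ = 0}

/-- Coderangements of `[n]` (permutations without foremaximum) with exactly `k` valleys and no
double ascent. -/
def DStar (n k : ℕ) : Finset (Equiv.Perm (Fin n)) :=
  {σ | fmax σ = 0 ∧ valley σ = k ∧ da σ = 0}

end PermStat

/-!
Both sums are evaluated letter by letter, in increasing order of the letters, as weighted sums over
Motzkin paths. On the cyclic side the height after `m` steps is the number of arcs `(i, σ(i))` that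
start at or before `m` and end after it; on the linear side it is the number of maximal blocks,
formed by the letters `1, …, m` in the word of `σ`, that are preceded by a larger letter. In both
cases the total weight contributed by the next letter depends only on the height. The level weights
agree, and an up step from height `i` followed by its matching down step has weight `w * [i+1]²` on
the cyclic side, split as `w` and `[i+1]²`, and on the linear side split as `w * [i+1]` and `[i+1]`,
where `[i] = ∑ pᵃ qᵇ` over `a + b = i - 1`. Hence the two path sums coincide, and comparing
coefficients of `wᵏ yʲ` gives the theorem.
-/

namespace PermStat

open Finset

section Motzkin

variable {R : Type*} [CommSemiring R]

/-- One step of the Motzkin recursion: if `c h` is the total weight of the lattice paths that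
start at height `h`, this is the total weight of the paths with one step prepended. The weights
`up`, `level` and `down` are indexed by the starting height of the step. -/
def motzkinStep (up level down c : ℕ → R) : ℕ → R
  | 0 => up 0 * c 1 + level 0 * c 0
  | h + 1 => up (h + 1) * c (h + 2) + level (h + 1) * c (h + 1) + down (h + 1) * c h

/-- The total weight of the Motzkin paths with `r` steps from height `h` to height `0`, where the
weight of a path is the product of the weights of its steps, indexed by their starting heights. -/
def motzkinSum (up level down : ℕ → R) (r h : ℕ) : R :=
  (motzkinStep up level down)^[r] (Pi.single 0 1) h

lemma motzkinSum_succ (up level down : ℕ → R) (r h : ℕ) :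
    motzkinSum up level down (r + 1) h =
      motzkinStep up level down (motzkinSum up level down r) h := by
  rw [motzkinSum, Function.iterate_succ_apply']
  rfl

lemma motzkinStep_eq {down : ℕ → R} (hdown : down 0 = 0) (up level c : ℕ → R) (h : ℕ) :
    motzkinStep up level down c h = up h * c (h + 1) + level h * c h + down h * c (h - 1) := by
  cases h <;> simp [motzkinStep, hdown]

/-- Only the products of an up step with the matching down step enter the weight of a closed path,
so a factor of the down steps can be moved to the up steps. -/
lemma motzkinSum_mul_down (up level down f : ℕ → R) (r h : ℕ) :
    motzkinSum up level (fun i => f i * down i) r h =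
      (∏ i ∈ range h, f (i + 1)) * motzkinSum (fun i => up i * f (i + 1)) level down r h := by
  induction r generalizing h with
  | zero => cases h <;> simp [motzkinSum]
  | succ r ih =>
    simp only [motzkinSum_succ]
    cases h with
    | zero => simp [motzkinStep, ih, mul_assoc]
    | succ h =>
      simp only [motzkinStep, ih, prod_range_succ]
      ring

/-- `cls m s` collects the objects that are in the state `s` once the letters below `m` are
processed; the sum remembers only the height `h` of the state. -/
theorem sum_prod_eq_motzkinSum {Ω ι : Type*} {n : ℕ} {up level down : ℕ → R}
    (wt : Ω → Fin n → R) (IsState : ℕ → ℕ → ι → Prop) (cls : ℕ → ι → Finset Ω)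
    (card_cls : ∀ h s, IsState n h s → #(cls n s) = if h = 0 then 1 else 0)
    (sum_cls : ∀ (x : Fin n) h s, IsState x h s → ∀ (F : Ω → R) (c : ℕ → R),
      (∀ h' s', IsState (x + 1) h' s' → ∑ ω ∈ cls (x + 1) s', F ω = c h') →
      ∑ ω ∈ cls x s, wt ω x * F ω = motzkinStep up level down c h)
    {m r : ℕ} (hmr : m + r = n) {h : ℕ} {s : ι} (hs : IsState m h s) :
    ∑ ω ∈ cls m s, ∏ x : Fin n with m ≤ x.val, wt ω x = motzkinSum up level down r h := by
  induction r generalizing m h s with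
  | zero =>
    obtain rfl : m = n := hmr
    have hlate : ({x : Fin m | m ≤ x.val} : Finset _) = ∅ :=
      filter_false_of_mem fun x _ => not_le.2 x.isLt
    simp [hlate, card_cls h s hs, motzkinSum, Pi.single_apply]
  | succ r ih =>
    obtain ⟨x, rfl⟩ : ∃ x : Fin n, x.val = m := ⟨⟨m, by omega⟩, rfl⟩
    have hlate : ({z : Fin n | x.val ≤ z.val} : Finset _) =
        insert x ({z : Fin n | x.val + 1 ≤ z.val} : Finset _) := by
      ext z
      simp only [mem_filter, mem_univ, true_and, mem_insert, Fin.ext_iff]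
      omega
    have hstep := sum_cls x h s hs (fun ω => ∏ z : Fin n with x.val + 1 ≤ z.val, wt ω z)
      (motzkinSum up level down r) fun h' s' hs' => ih (m := x.val + 1) (by omega) hs'
    rw [motzkinSum_succ, ← hstep]
    refine sum_congr rfl fun ω _ => ?_
    rw [hlate, prod_insert (by simp)]

end Motzkin

section Rank

variable {α : Type*} {s : Finset α} {r : α → α → Prop} [IsStrictOrder α r]

lemma card_pred_lt_card_pred [DecidableRel r] {a b : α} (ha : a ∈ s) (hab : r a b) :
    #{c ∈ s | r c a} < #{c ∈ s | r c b} := by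
  refine card_lt_card ((ssubset_iff_of_subset ?_).2 ⟨a, ?_, ?_⟩)
  · exact monotone_filter_right s fun c _ hca => _root_.trans hca hab
  · exact mem_filter.2 ⟨ha, hab⟩
  · simp [irrefl_of r a]

lemma injOn_card_pred [DecidableRel r] (hs : IsChain r (s : Set α)) :
    Set.InjOn (fun b => #{a ∈ s | r a b}) s := by
  intro a ha b hb hab
  by_contra hne
  rcases hs ha hb hne with h | h
  · exact (card_pred_lt_card_pred ha h).ne hab
  · exact (card_pred_lt_card_pred hb h).ne' hab

lemma image_card_pred [DecidableRel r] (hs : IsChain r (s : Set α)) :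
    s.image (fun b => #{a ∈ s | r a b}) = range #s := by
  refine eq_of_subset_of_card_le (image_subset_iff.2 fun b hb => mem_range.2 ?_) ?_
  · exact card_lt_card (filter_ssubset.2 ⟨b, hb, irrefl_of r b⟩)
  · rw [card_range, card_image_of_injOn (injOn_card_pred hs)]

lemma sum_card_pred [DecidableRel r] {M : Type*} [AddCommMonoid M] (hs : IsChain r (s : Set α))
    (F : ℕ → M) : ∑ b ∈ s, F #{a ∈ s | r a b} = ∑ i ∈ range #s, F i := by
  rw [← image_card_pred hs, sum_image (injOn_card_pred hs)]

lemma card_pred_add_card_succ [DecidableRel r] (hs : IsChain r (s : Set α)) {b : α} (hb : b ∈ s) :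
    #{a ∈ s | r a b} + #{a ∈ s | r b a} + 1 = #s := by
  classical
  rw [← card_erase_add_one hb, ← card_union_of_disjoint]
  · congr 2
    ext a
    have hirr := irrefl_of r b
    have htot : a ∈ s → a ≠ b → r a b ∨ r b a := fun ha => hs ha hb
    grind
  · refine disjoint_filter.2 fun a _ hab hba => asymm_of r hab hba

end Rank

lemma existsUnique_equiv_fin {α : Type*} {n : ℕ} (r : α → α → Prop) [IsStrictTotalOrder α r]
    [Fintype α] (hn : Fintype.card α = n) :
    ∃! e : α ≃ Fin n, ∀ a b, e a < e b ↔ r a b := by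
  classical
  let _ := linearOrderOfSTO r
  refine ⟨(Fintype.orderIsoFinOfCardEq α hn).symm.toEquiv,
    fun a b => (Fintype.orderIsoFinOfCardEq α hn).symm.lt_iff_lt, fun e he => ?_⟩
  let e' : α ≃o Fin n := (StrictMono.orderIsoOfSurjective e (fun a b => (he a b).2) e.surjective)
  have : e' = (Fintype.orderIsoFinOfCardEq α hn).symm := Subsingleton.elim _ _
  ext a
  exact congrArg Fin.val (DFunLike.congr_fun this a)

section PQNat

variable {R : Type*} [CommSemiring R]

/-- The `(p,q)`-analogue `p ^ (h - 1) + p ^ (h - 2) * q + ⋯ + q ^ (h - 1)` of the natural number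
`h`. -/
def pqNat (p q : R) (h : ℕ) : R := ∑ i ∈ range h, q ^ i * p ^ (h - 1 - i)

lemma sum_pow_card_pred_mul_pow_card_succ {α : Type*} {s : Finset α} {r : α → α → Prop}
    [IsStrictOrder α r] [DecidableRel r] (hs : IsChain r (s : Set α)) (p q : R) :
    ∑ b ∈ s, q ^ #{a ∈ s | r a b} * p ^ #{a ∈ s | r b a} = pqNat p q #s := by
  rw [pqNat, ← sum_card_pred hs fun i => q ^ i * p ^ (#s - 1 - i)]
  refine sum_congr rfl fun b hb => ?_
  rw [show #{a ∈ s | r b a} = #s - 1 - #{a ∈ s | r a b} by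
    have := card_pred_add_card_succ hs hb
    omega]

end PQNat

section CyclicWeight

variable {n : ℕ}

/-- The number of nestings whose inner arc has `x` as its larger end, where the arcs are the pairs
`(i, σ(i))`; so `i` in the first set and `σ⁻¹(z)` in the second start the outer arc. -/
def nestAt (σ : Equiv.Perm (Fin n)) (x : Fin n) : ℕ :=
  #{i | i < σ.symm x ∧ σ.symm x ≤ x ∧ x < σ i} + #{z | z < σ x ∧ σ x < x ∧ x < σ.symm z}

/-- The number of crossings in which `x` is the larger end of the arc that closes first, where the
arcs are the pairs `(i, σ(i))`; the other arc starts at `j` or ends at `z`. -/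
def crosAt (σ : Equiv.Perm (Fin n)) (x : Fin n) : ℕ :=
  #{j | σ.symm x < j ∧ j ≤ x ∧ x < σ j} + #{z | σ x < z ∧ z < x ∧ x < σ.symm z}

lemma nest_eq_sum (σ : Equiv.Perm (Fin n)) : nest σ = ∑ x, nestAt σ x := by
  simp only [nest, nestAt, sum_add_distrib]
  rw [filter_or, card_union_of_disjoint
    (disjoint_filter.2 fun ij _ h h' => lt_asymm h.1 h'.1)]
  congr 1
  · simp only [card_filter, Fintype.sum_prod_type_right]
    rw [← Equiv.sum_comp σ.symm]
    simp only [Equiv.apply_symm_apply]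
  · simp only [card_filter, Fintype.sum_prod_type_right]
    refine sum_congr rfl fun j _ => ?_
    rw [← Equiv.sum_comp σ.symm]
    refine sum_congr rfl fun z _ => ?_
    simp only [Equiv.apply_symm_apply]
    grind

lemma cros_eq_sum (σ : Equiv.Perm (Fin n)) : cros σ = ∑ x, crosAt σ x := by
  simp only [cros, crosAt, sum_add_distrib]
  rw [filter_or, card_union_of_disjoint
    (disjoint_filter.2 fun ij _ h h' => lt_asymm h.1 h'.1)]
  congr 1
  · simp only [card_filter, Fintype.sum_prod_type]
    rw [← Equiv.sum_comp σ.symm]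
    simp only [Equiv.apply_symm_apply]
  · simp only [card_filter, Fintype.sum_prod_type_right]
    refine sum_congr rfl fun j _ => ?_
    rw [← Equiv.sum_comp σ.symm]
    refine sum_congr rfl fun z _ => ?_
    simp only [Equiv.apply_symm_apply]
    grind

variable {R : Type*} [CommSemiring R]

/-- The contribution of the letter `x` to the weight of `σ` in `B n p q 1 0 1 w y`. -/
def cycWt (p q w y : R) (σ : Equiv.Perm (Fin n)) (x : Fin n) : R :=
  p ^ nestAt σ x * q ^ crosAt σ x * (if σ.symm x < x ∧ x < σ x then 0 else 1) *
    (if x < σ.symm x ∧ x < σ x then w else 1) * (if σ x = x then y else 1)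

lemma B_eq_sum_prod_cycWt (p q w y : R) :
    B n p q 1 0 1 w y = ∑ σ : Equiv.Perm (Fin n), ∏ x, cycWt p q w y σ x := by
  simp only [B, cycWt, prod_mul_distrib, prod_pow_eq_pow_sum, nest_eq_sum, cros_eq_sum, prod_ite,
    prod_const, one_pow, mul_one, cda, cvalley, fix, Equiv.Perm.inv_def]

end CyclicWeight

section CyclicClasses

variable {n : ℕ}

/-- The letters `< m` that are the source of no arc of `E`. -/
def freeSrc (m : ℕ) (E : Finset (Fin n × Fin n)) : Finset (Fin n) :=
  {a | a.val < m ∧ ∀ b, (a, b) ∉ E}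

/-- The letters `< m` that are the target of no arc of `E`. -/
def freeTgt (m : ℕ) (E : Finset (Fin n × Fin n)) : Finset (Fin n) :=
  {b | b.val < m ∧ ∀ a, (a, b) ∉ E}

/-- `E` is the graph of a partial injection of the letters `< m` to themselves, with `h` free
sources and `h` free targets. -/
structure IsPartialInj (m h : ℕ) (E : Finset (Fin n × Fin n)) : Prop where
  lt : ∀ a b, (a, b) ∈ E → a.val < m ∧ b.val < m
  fn : ∀ a b c, (a, b) ∈ E → (a, c) ∈ E → b = c
  inj : ∀ a b c, (a, c) ∈ E → (b, c) ∈ E → a = b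
  card_src : #(freeSrc m E) = h
  card_tgt : #(freeTgt m E) = h

/-- The permutations whose arcs `(a, σ a)` between letters `< m` are those of `E`. -/
def arcClass (m : ℕ) (E : Finset (Fin n × Fin n)) : Finset (Equiv.Perm (Fin n)) :=
  {σ | ∀ a b : Fin n, a.val < m → b.val < m → (σ a = b ↔ (a, b) ∈ E)}

lemma mem_arcClass {m : ℕ} {E : Finset (Fin n × Fin n)} {σ : Equiv.Perm (Fin n)} :
    σ ∈ arcClass m E ↔ ∀ a b : Fin n, a.val < m → b.val < m → (σ a = b ↔ (a, b) ∈ E) := by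
  simp [arcClass]

section FreeLetters

variable {m h : ℕ} {E : Finset (Fin n × Fin n)} {σ : Equiv.Perm (Fin n)}

lemma mem_freeSrc {a : Fin n} : a ∈ freeSrc m E ↔ a.val < m ∧ ∀ b, (a, b) ∉ E := by
  simp [freeSrc]

lemma mem_freeTgt {b : Fin n} : b ∈ freeTgt m E ↔ b.val < m ∧ ∀ a, (a, b) ∉ E := by
  simp [freeTgt]

lemma mem_freeSrc_iff (hE : IsPartialInj m h E) (hσ : σ ∈ arcClass m E) (a : Fin n) :
    a ∈ freeSrc m E ↔ a.val < m ∧ m ≤ (σ a).val := by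
  rw [mem_freeSrc]
  have hlt := hE.lt a
  have := mem_arcClass.1 hσ a
  grind

lemma mem_freeTgt_iff (hE : IsPartialInj m h E) (hσ : σ ∈ arcClass m E) (b : Fin n) :
    b ∈ freeTgt m E ↔ b.val < m ∧ m ≤ (σ.symm b).val := by
  rw [mem_freeTgt]
  have hlt := fun a => hE.lt a b
  have := fun a => mem_arcClass.1 hσ a b
  have : σ (σ.symm b) = b := σ.apply_symm_apply b
  grind

lemma freeSrc_insert (a b : Fin n) : freeSrc m (insert (a, b) E) = (freeSrc m E).erase a := by
  ext c
  have hc : (∀ d, ¬(c = a ∧ d = b)) ↔ c ≠ a := by simp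
  simp only [mem_freeSrc, mem_insert, mem_erase, Prod.mk.injEq, not_or, forall_and, hc]
  tauto

lemma freeTgt_insert (a b : Fin n) : freeTgt m (insert (a, b) E) = (freeTgt m E).erase b := by
  ext c
  have hc : (∀ d, ¬(d = a ∧ c = b)) ↔ c ≠ b := by simp
  simp only [mem_freeTgt, mem_insert, mem_erase, Prod.mk.injEq, not_or, forall_and, hc]
  tauto

lemma arcClass_eq_empty (hE : IsPartialInj n h E) (hh : h ≠ 0) : arcClass n E = ∅ := by
  refine eq_empty_of_forall_notMem fun σ hσ => hh ?_
  rw [← hE.card_src, card_eq_zero]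
  refine eq_empty_of_forall_notMem fun a ha => ?_
  exact (((mem_freeSrc_iff hE hσ a).1 ha).2.trans_lt (σ a).isLt).false

lemma card_arcClass_eq_one (hE : IsPartialInj n 0 E) : #(arcClass n E) = 1 := by
  have hsrc (a : Fin n) : ∃ b, (a, b) ∈ E := by
    have := eq_empty_iff_forall_notMem.1 (card_eq_zero.1 hE.card_src) a
    simpa [mem_freeSrc] using this
  choose f hf using hsrc
  have hinj : Function.Injective f := fun a b hab => hE.inj a b (f b) (hab ▸ hf a) (hf b)
  refine card_eq_one.2 ⟨Equiv.ofBijective f (Finite.injective_iff_bijective.1 hinj), ?_⟩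
  ext σ
  rw [mem_arcClass, mem_singleton]
  constructor
  · intro hσ
    exact Equiv.ext fun a => (hσ a (f a) a.isLt (f a).isLt).2 (hf a)
  · rintro rfl a b _ _
    exact ⟨fun hab => hab ▸ hf a, hE.fn a _ _ (hf a)⟩

lemma card_arcClass (hE : IsPartialInj n h E) : #(arcClass n E) = if h = 0 then 1 else 0 := by
  split_ifs with hh
  · exact card_arcClass_eq_one (hh ▸ hE)
  · rw [arcClass_eq_empty hE hh, card_empty]

end FreeLetters

end CyclicClasses

section CyclicChildren

variable {n h : ℕ} {E : Finset (Fin n × Fin n)} {x : Fin n} {σ : Equiv.Perm (Fin n)}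

lemma mem_arcClass_succ :
    σ ∈ arcClass (x.val + 1) E ↔ σ ∈ arcClass x.val E ∧ (∀ a < x, σ a = x ↔ (a, x) ∈ E) ∧
      (∀ b < x, σ x = b ↔ (x, b) ∈ E) ∧ (σ x = x ↔ (x, x) ∈ E) := by
  simp only [mem_arcClass, Nat.lt_succ_iff, ← Fin.lt_def, ← Fin.le_def]
  constructor
  · grind
  · rintro ⟨hlt, hsrc, htgt, hfix⟩ a b ha hb
    rcases ha.lt_or_eq with ha | rfl <;> rcases hb.lt_or_eq with hb | rfl <;> grind

lemma mem_arcClass_insert {a b : Fin n} (hab : x ≤ a ∨ x ≤ b) :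
    σ ∈ arcClass x.val (insert (a, b) E) ↔ σ ∈ arcClass x.val E := by
  simp only [mem_arcClass, mem_insert, Prod.mk.injEq, ← Fin.lt_def]
  refine forall₄_congr fun c d hc hd => ?_
  grind

lemma IsPartialInj.notMem_left (hE : IsPartialInj x.val h E) (b : Fin n) : (x, b) ∉ E :=
  fun hb => (hE.lt _ _ hb).1.false

lemma IsPartialInj.notMem_right (hE : IsPartialInj x.val h E) (a : Fin n) : (a, x) ∉ E :=
  fun ha => (hE.lt _ _ ha).2.false

lemma arcClass_valley (hE : IsPartialInj x.val h E) :
    {σ ∈ arcClass x.val E | x < σ.symm x ∧ x < σ x} = arcClass (x.val + 1) E := by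
  ext σ
  simp only [mem_filter, mem_arcClass_succ, hE.notMem_left, hE.notMem_right, iff_false]
  have hx := σ.apply_symm_apply x
  grind

lemma arcClass_fixed (hE : IsPartialInj x.val h E) :
    {σ ∈ arcClass x.val E | σ x = x} = arcClass (x.val + 1) (insert (x, x) E) := by
  ext σ
  simp only [mem_filter, mem_arcClass_succ, mem_arcClass_insert (.inl le_rfl), mem_insert,
    hE.notMem_left, hE.notMem_right]
  have hinj (a) : σ a = σ x ↔ a = x := σ.injective.eq_iff
  grind

lemma arcClass_doubleDrop (hE : IsPartialInj x.val h E) {t : Fin n} (ht : t ∈ freeTgt x.val E) :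
    {σ ∈ arcClass x.val E | (x < σ.symm x ∧ σ x < x) ∧ σ x = t} =
      arcClass (x.val + 1) (insert (x, t) E) := by
  have htx : t < x := (mem_freeTgt.1 ht).1
  ext σ
  simp only [mem_filter, mem_arcClass_succ, mem_arcClass_insert (.inl le_rfl), mem_insert,
    hE.notMem_left, hE.notMem_right, Prod.mk.injEq]
  have hx := σ.apply_symm_apply x
  have hinv (a) : σ.symm (σ a) = a := σ.symm_apply_apply a
  grind

lemma arcClass_peak (hE : IsPartialInj x.val h E) {s t : Fin n} (hs : s ∈ freeSrc x.val E)
    (ht : t ∈ freeTgt x.val E) :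
    {σ ∈ arcClass x.val E | (σ.symm x < x ∧ σ x < x) ∧ (σ.symm x, σ x) = (s, t)} =
      arcClass (x.val + 1) (insert (s, x) (insert (x, t) E)) := by
  have hsx : s < x := (mem_freeSrc.1 hs).1
  have htx : t < x := (mem_freeTgt.1 ht).1
  ext σ
  simp only [mem_filter, mem_arcClass_succ, mem_arcClass_insert (.inl le_rfl),
    mem_arcClass_insert (.inr le_rfl), mem_insert, hE.notMem_left, hE.notMem_right, Prod.mk.injEq]
  have hx := σ.apply_symm_apply x
  have hinv (a) : σ.symm (σ a) = a := σ.symm_apply_apply a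
  grind

lemma IsPartialInj.freeSrc_succ (hE : IsPartialInj x.val h E) :
    freeSrc (x.val + 1) E = insert x (freeSrc x.val E) := by
  ext a
  have := hE.notMem_left
  simp only [mem_freeSrc, mem_insert]
  grind

lemma IsPartialInj.freeTgt_succ (hE : IsPartialInj x.val h E) :
    freeTgt (x.val + 1) E = insert x (freeTgt x.val E) := by
  ext a
  have := hE.notMem_right
  simp only [mem_freeTgt, mem_insert]
  grind

lemma notMem_freeSrc_self : x ∉ freeSrc x.val E := by simp [mem_freeSrc]

lemma notMem_freeTgt_self : x ∉ freeTgt x.val E := by simp [mem_freeTgt]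

lemma IsPartialInj.valley (hE : IsPartialInj x.val h E) :
    IsPartialInj (x.val + 1) (h + 1) E where
  lt a b hab := by have := hE.lt a b hab; omega
  fn := hE.fn
  inj := hE.inj
  card_src := by rw [hE.freeSrc_succ, card_insert_of_notMem notMem_freeSrc_self, hE.card_src]
  card_tgt := by rw [hE.freeTgt_succ, card_insert_of_notMem notMem_freeTgt_self, hE.card_tgt]

lemma IsPartialInj.fixed (hE : IsPartialInj x.val h E) :
    IsPartialInj (x.val + 1) h (insert (x, x) E) where
  lt a b := by have := hE.lt a b; grind
  fn a b c := by have := hE.notMem_left; have := hE.fn a b c; grind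
  inj a b c := by have := hE.notMem_right; have := hE.inj a b c; grind
  card_src := by
    rw [freeSrc_insert, hE.freeSrc_succ, erase_insert notMem_freeSrc_self, hE.card_src]
  card_tgt := by
    rw [freeTgt_insert, hE.freeTgt_succ, erase_insert notMem_freeTgt_self, hE.card_tgt]

lemma IsPartialInj.doubleDrop (hE : IsPartialInj x.val h E) {t : Fin n}
    (ht : t ∈ freeTgt x.val E) : IsPartialInj (x.val + 1) h (insert (x, t) E) where
  lt a b := by have := hE.lt a b; have := mem_freeTgt.1 ht; grind
  fn a b c := by have := hE.notMem_left; have := hE.fn a b c; grind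
  inj a b c := by have := hE.inj a b c; have := mem_freeTgt.1 ht; grind
  card_src := by
    rw [freeSrc_insert, hE.freeSrc_succ, erase_insert notMem_freeSrc_self, hE.card_src]
  card_tgt := by
    rw [freeTgt_insert, hE.freeTgt_succ, card_erase_of_mem (mem_insert_of_mem ht),
      card_insert_of_notMem notMem_freeTgt_self, hE.card_tgt, Nat.add_sub_cancel]

lemma IsPartialInj.peak (hE : IsPartialInj x.val h E) {s t : Fin n} (hs : s ∈ freeSrc x.val E)
    (ht : t ∈ freeTgt x.val E) :
    IsPartialInj (x.val + 1) (h - 1) (insert (s, x) (insert (x, t) E)) where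
  lt a b := by have := hE.lt a b; have := mem_freeSrc.1 hs; have := mem_freeTgt.1 ht; grind
  fn a b c := by
    have := hE.notMem_left; have := hE.fn a b c; have := mem_freeSrc.1 hs; grind
  inj a b c := by
    have := hE.notMem_right; have := hE.inj a b c; have := mem_freeTgt.1 ht; grind
  card_src := by
    rw [freeSrc_insert, freeSrc_insert, hE.freeSrc_succ, erase_insert notMem_freeSrc_self,
      card_erase_of_mem hs, hE.card_src]
  card_tgt := by
    rw [freeTgt_insert, freeTgt_insert, hE.freeTgt_succ, erase_right_comm,
      erase_insert notMem_freeTgt_self, card_erase_of_mem ht, hE.card_tgt]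

end CyclicChildren

section CyclicStep

variable {n h : ℕ} {E : Finset (Fin n × Fin n)} {x : Fin n} {σ : Equiv.Perm (Fin n)}

lemma mem_freeSrc_iff_of_ne (hE : IsPartialInj x.val h E) (hσ : σ ∈ arcClass x.val E) {a : Fin n}
    (ha : a ≠ σ.symm x) : a ∈ freeSrc x.val E ↔ a < x ∧ x < σ a := by
  rw [mem_freeSrc_iff hE hσ, ← Fin.lt_def, ← Fin.le_def, le_iff_lt_or_eq, or_iff_left]
  exact fun hxa => ha ((Equiv.eq_symm_apply σ).2 hxa.symm)

lemma mem_freeTgt_iff_of_ne (hE : IsPartialInj x.val h E) (hσ : σ ∈ arcClass x.val E) {b : Fin n}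
    (hb : b ≠ σ x) : b ∈ freeTgt x.val E ↔ b < x ∧ x < σ.symm b := by
  rw [mem_freeTgt_iff hE hσ, ← Fin.lt_def, ← Fin.le_def, le_iff_lt_or_eq, or_iff_left]
  exact fun hxb => hb ((Equiv.eq_symm_apply σ).1 hxb).symm

lemma nestAt_eq (hE : IsPartialInj x.val h E) (hσ : σ ∈ arcClass x.val E) :
    nestAt σ x = (if σ.symm x ≤ x then #{a ∈ freeSrc x.val E | a < σ.symm x} else 0) +
      (if σ x < x then #{b ∈ freeTgt x.val E | b < σ x} else 0) := by
  unfold nestAt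
  congr 1
  · split_ifs with hx
    · congr 1
      ext a
      have := mem_freeSrc_iff_of_ne hE hσ (a := a)
      grind
    · simp [hx]
  · split_ifs with hx
    · congr 1
      ext b
      have := mem_freeTgt_iff_of_ne hE hσ (b := b)
      grind
    · simp [hx]

lemma crosAt_eq (hE : IsPartialInj x.val h E) (hσ : σ ∈ arcClass x.val E) (hx : σ x ≤ x) :
    crosAt σ x = #{a ∈ freeSrc x.val E | σ.symm x < a} + #{b ∈ freeTgt x.val E | σ x < b} := by
  unfold crosAt
  congr 2
  · ext a
    have := mem_freeSrc_iff_of_ne hE hσ (a := a)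
    grind
  · ext b
    have := mem_freeTgt_iff_of_ne hE hσ (b := b)
    grind

lemma crosAt_of_valley (hx : x < σ.symm x) (hx' : x < σ x) : crosAt σ x = 0 := by
  simp only [crosAt, Nat.add_eq_zero_iff, card_eq_zero, filter_eq_empty_iff]
  grind

lemma nestAt_of_valley (hx : x < σ.symm x) (hx' : x < σ x) : nestAt σ x = 0 := by
  simp [nestAt, hx.not_ge, hx'.not_gt]

variable {R : Type*} [CommSemiring R] (p q w y : R)

lemma cycWt_valley (hx : x < σ.symm x) (hx' : x < σ x) : cycWt p q w y σ x = w := by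
  simp [cycWt, nestAt_of_valley hx hx', crosAt_of_valley hx hx', hx, hx', hx.not_gt, hx'.ne']

lemma cycWt_doubleExc (hx : σ.symm x < x) (hx' : x < σ x) : cycWt p q w y σ x = 0 := by
  simp [cycWt, hx, hx']

lemma cycWt_fixed (hE : IsPartialInj x.val h E) (hσ : σ ∈ arcClass x.val E) (hx : σ x = x) :
    cycWt p q w y σ x = y * p ^ h := by
  have hx' : σ.symm x = x := by rw [Equiv.symm_apply_eq, hx]
  have hsrc : {a ∈ freeSrc x.val E | a < x} = freeSrc x.val E :=
    filter_true_of_mem fun a ha => (mem_freeSrc.1 ha).1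
  have hsrc' : {a ∈ freeSrc x.val E | x < a} = ∅ :=
    filter_false_of_mem fun a ha => lt_asymm (mem_freeSrc.1 ha).1
  have htgt : {b ∈ freeTgt x.val E | x < b} = ∅ :=
    filter_false_of_mem fun b hb => lt_asymm (mem_freeTgt.1 hb).1
  simp [cycWt, nestAt_eq hE hσ, crosAt_eq hE hσ hx.le, hx, hx', hsrc, hsrc', htgt, hE.card_src,
    mul_comm]

lemma cycWt_doubleDrop (hE : IsPartialInj x.val h E) (hσ : σ ∈ arcClass x.val E)
    (hx : x < σ.symm x) (hx' : σ x < x) :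
    cycWt p q w y σ x =
      q ^ #{b ∈ freeTgt x.val E | b > σ x} * p ^ #{b ∈ freeTgt x.val E | σ x > b} := by
  have hsrc : {a ∈ freeSrc x.val E | σ.symm x < a} = ∅ :=
    filter_false_of_mem fun a ha => ((mem_freeSrc.1 ha).1.trans hx).not_gt
  simp [cycWt, nestAt_eq hE hσ, crosAt_eq hE hσ hx'.le, hx.not_gt, hx.not_ge, hx', hx'.ne,
    hx'.not_gt, hsrc, mul_comm]

lemma cycWt_peak (hE : IsPartialInj x.val h E) (hσ : σ ∈ arcClass x.val E)
    (hx : σ.symm x < x) (hx' : σ x < x) :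
    cycWt p q w y σ x =
      (q ^ #{a ∈ freeSrc x.val E | a > σ.symm x} * p ^ #{a ∈ freeSrc x.val E | σ.symm x > a}) *
      (q ^ #{b ∈ freeTgt x.val E | b > σ x} * p ^ #{b ∈ freeTgt x.val E | σ x > b}) := by
  simp only [cycWt, nestAt_eq hE hσ, crosAt_eq hE hσ hx'.le, hx.le, hx', hx'.ne, hx.not_gt,
    hx'.not_gt, if_true, and_false, if_false, mul_one, pow_add, gt_iff_lt]
  ring

lemma sum_pow_card_gt_mul_pow_card_lt {α : Type*} [LinearOrder α] (s : Finset α) :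
    ∑ b ∈ s, q ^ #{a ∈ s | a > b} * p ^ #{a ∈ s | b > a} = pqNat p q #s :=
  sum_pow_card_pred_mul_pow_card_succ (r := (· > ·))
    (fun _ _ _ _ hab => hab.lt_or_gt.symm) p q

variable {p q w y} {F : Equiv.Perm (Fin n) → R} {c : ℕ → R}

lemma sum_valley (hE : IsPartialInj x.val h E)
    (hF : ∀ h' E', IsPartialInj (x.val + 1) h' E' → ∑ σ ∈ arcClass (x.val + 1) E', F σ = c h') :
    ∑ σ ∈ arcClass x.val E with x < σ.symm x ∧ x < σ x, cycWt p q w y σ x * F σ =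
      w * c (h + 1) := by
  rw [← hF _ _ hE.valley, ← arcClass_valley hE, mul_sum]
  refine sum_congr rfl fun σ hσ => ?_
  obtain ⟨-, hx, hx'⟩ := mem_filter.1 hσ
  rw [cycWt_valley p q w y hx hx']

lemma sum_fixed (hE : IsPartialInj x.val h E)
    (hF : ∀ h' E', IsPartialInj (x.val + 1) h' E' → ∑ σ ∈ arcClass (x.val + 1) E', F σ = c h') :
    ∑ σ ∈ arcClass x.val E with σ x = x, cycWt p q w y σ x * F σ = y * p ^ h * c h := by
  rw [← hF _ _ hE.fixed, ← arcClass_fixed hE, mul_sum]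
  refine sum_congr rfl fun σ hσ => ?_
  obtain ⟨hσ, hx⟩ := mem_filter.1 hσ
  rw [cycWt_fixed p q w y hE hσ hx]

lemma sum_doubleDrop (hE : IsPartialInj x.val h E)
    (hF : ∀ h' E', IsPartialInj (x.val + 1) h' E' → ∑ σ ∈ arcClass (x.val + 1) E', F σ = c h') :
    ∑ σ ∈ arcClass x.val E with x < σ.symm x ∧ σ x < x, cycWt p q w y σ x * F σ =
      pqNat p q h * c h := by
  have hmaps : ∀ σ ∈ {σ ∈ arcClass x.val E | x < σ.symm x ∧ σ x < x}, σ x ∈ freeTgt x.val E := by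
    intro σ hσ
    obtain ⟨hσ, -, hx'⟩ := mem_filter.1 hσ
    exact (mem_freeTgt_iff hE hσ _).2 ⟨hx', by simp⟩
  rw [← sum_fiberwise_of_maps_to hmaps, ← hE.card_tgt, ← sum_pow_card_gt_mul_pow_card_lt, sum_mul]
  refine sum_congr rfl fun t ht => ?_
  rw [hE.card_tgt, ← hF _ _ (hE.doubleDrop ht), ← arcClass_doubleDrop hE ht, mul_sum, filter_filter]
  refine sum_congr rfl fun σ hmem => ?_
  obtain ⟨hσ, ⟨hx, hx'⟩, rfl⟩ := mem_filter.1 hmem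
  rw [cycWt_doubleDrop p q w y hE hσ hx hx']

lemma sum_peak (hE : IsPartialInj x.val h E)
    (hF : ∀ h' E', IsPartialInj (x.val + 1) h' E' → ∑ σ ∈ arcClass (x.val + 1) E', F σ = c h') :
    ∑ σ ∈ arcClass x.val E with σ.symm x < x ∧ σ x < x, cycWt p q w y σ x * F σ =
      pqNat p q h ^ 2 * c (h - 1) := by
  have hmaps : ∀ σ ∈ {σ ∈ arcClass x.val E | σ.symm x < x ∧ σ x < x},
      (σ.symm x, σ x) ∈ freeSrc x.val E ×ˢ freeTgt x.val E := by
    intro σ hσ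
    obtain ⟨hσ, hx, hx'⟩ := mem_filter.1 hσ
    rw [mem_product, mem_freeSrc_iff hE hσ, mem_freeTgt_iff hE hσ]
    exact ⟨⟨hx, by simp⟩, hx', by simp⟩
  have hsq : pqNat p q h ^ 2 = pqNat p q #(freeSrc x.val E) * pqNat p q #(freeTgt x.val E) := by
    rw [hE.card_src, hE.card_tgt, sq]
  rw [← sum_fiberwise_of_maps_to hmaps, hsq, ← sum_pow_card_gt_mul_pow_card_lt,
    ← sum_pow_card_gt_mul_pow_card_lt, sum_mul_sum, ← sum_product', sum_mul]
  refine sum_congr rfl fun ⟨s, t⟩ hst => ?_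
  obtain ⟨hs, ht⟩ := mem_product.1 hst
  rw [← hF _ _ (hE.peak hs ht), ← arcClass_peak hE hs ht, mul_sum, filter_filter]
  refine sum_congr rfl fun σ hmem => ?_
  obtain ⟨hσ, ⟨hx, hx'⟩, hst⟩ := mem_filter.1 hmem
  obtain ⟨rfl, rfl⟩ := Prod.mk.inj hst
  rw [cycWt_peak p q w y hE hσ hx hx']

lemma cycWt_mul_eq_add (a : R) :
    cycWt p q w y σ x * a =
      (if x < σ.symm x ∧ x < σ x then cycWt p q w y σ x * a else 0) +
      (if σ x = x then cycWt p q w y σ x * a else 0) +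
      (if x < σ.symm x ∧ σ x < x then cycWt p q w y σ x * a else 0) +
      (if σ.symm x < x ∧ σ x < x then cycWt p q w y σ x * a else 0) := by
  have hfix : σ.symm x = x ↔ σ x = x := by rw [Equiv.symm_apply_eq, eq_comm]
  by_cases hexc : σ.symm x < x ∧ x < σ x
  · simp [cycWt_doubleExc p q w y hexc.1 hexc.2]
  · split_ifs <;> first | (exfalso; grind) | simp

lemma sum_arcClass_cycWt (hE : IsPartialInj x.val h E)
    (hF : ∀ h' E', IsPartialInj (x.val + 1) h' E' → ∑ σ ∈ arcClass (x.val + 1) E', F σ = c h') :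
    ∑ σ ∈ arcClass x.val E, cycWt p q w y σ x * F σ =
      motzkinStep (fun _ => w) (fun i => pqNat p q i + y * p ^ i) (fun i => pqNat p q i ^ 2)
        c h := by
  rw [sum_congr rfl fun σ _ => cycWt_mul_eq_add (F σ), motzkinStep_eq (by simp [pqNat])]
  simp only [sum_add_distrib, ← sum_filter, sum_valley hE hF, sum_fixed hE hF,
    sum_doubleDrop hE hF, sum_peak hE hF]
  ring

theorem B_eq_motzkinSum (p q w y : R) :
    B n p q 1 0 1 w y =
      motzkinSum (fun _ => w) (fun i => pqNat p q i + y * p ^ i) (fun i => pqNat p q i ^ 2)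
        n 0 := by
  have hempty : IsPartialInj 0 0 (∅ : Finset (Fin n × Fin n)) :=
    ⟨by simp, by simp, by simp, by simp [freeSrc], by simp [freeTgt]⟩
  rw [B_eq_sum_prod_cycWt, ← sum_prod_eq_motzkinSum (cycWt p q w y) IsPartialInj arcClass
    (fun _ _ => card_arcClass) (fun _ _ _ hE _ _ => sum_arcClass_cycWt hE) (zero_add n) hempty]
  simp [arcClass]

end CyclicStep

section BlockClass

variable {n m h : ℕ} {σ : Equiv.Perm (Fin n)} {x a : Fin n} {r : Finset (Fin n × Fin n)}
  {T : Finset (Fin n)}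

/-- In the word of `σ`, the letter `a` has a left neighbour, and it is at least `m`. -/
def LeftNbrGE (σ : Equiv.Perm (Fin n)) (m : ℕ) (a : Fin n) : Prop :=
  ∃ c, m ≤ c.val ∧ (σ.symm c).val + 1 = (σ.symm a).val

/-- In the word of `σ`, the letter `x` has a right neighbour, and it is smaller than `x`. -/
def RightNbrLT (σ : Equiv.Perm (Fin n)) (x : Fin n) : Prop :=
  ∃ c < x, (σ.symm x).val + 1 = (σ.symm c).val

/-- The letter `x` is a left-to-right maximum of the word of `σ`. -/
def IsLeftMax (σ : Equiv.Perm (Fin n)) (x : Fin n) : Prop :=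
  ∀ c, σ.symm c < σ.symm x → c < x

instance (σ : Equiv.Perm (Fin n)) (m : ℕ) : DecidablePred (LeftNbrGE σ m) :=
  fun a => by unfold LeftNbrGE; infer_instance

instance (σ : Equiv.Perm (Fin n)) : DecidablePred (RightNbrLT σ) :=
  fun a => by unfold RightNbrLT; infer_instance

instance (σ : Equiv.Perm (Fin n)) : DecidablePred (IsLeftMax σ) :=
  fun a => by unfold IsLeftMax; infer_instance

/-- The letters smaller than `x` that stand to the right of `x` in the word of `σ`. -/
def smallerAfter (σ : Equiv.Perm (Fin n)) (x : Fin n) : Finset (Fin n) :=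
  {a | a < x ∧ σ.symm x < σ.symm a}

lemma mem_smallerAfter : a ∈ smallerAfter σ x ↔ a < x ∧ σ.symm x < σ.symm a := by
  simp [smallerAfter]

/-- The letters that play the part of `1` in an occurrence of `31-2` in which `x` is the `2`. -/
def descentBottomsBefore (σ : Equiv.Perm (Fin n)) (x : Fin n) : Finset (Fin n) :=
  {a | a < x ∧ a ∉ smallerAfter σ x ∧ LeftNbrGE σ (x.val + 1) a}

/-- The letters that play the part of `1` in an occurrence of `2-31` in which `x` is the `2`. -/
def descentBottomsAfter (σ : Equiv.Perm (Fin n)) (x : Fin n) : Finset (Fin n) :=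
  {a ∈ smallerAfter σ x | LeftNbrGE σ (x.val + 1) a}

lemma leftNbrGE_succ_iff :
    LeftNbrGE σ (x.val + 1) a ↔ LeftNbrGE σ x a ∧ (σ.symm x).val + 1 ≠ (σ.symm a).val := by
  constructor
  · rintro ⟨c, hxc, hca⟩
    refine ⟨⟨c, by omega, hca⟩, fun hxa => ?_⟩
    obtain rfl : c = x := σ.symm.injective (Fin.ext (by omega))
    omega
  · rintro ⟨⟨c, hxc, hca⟩, hxa⟩
    have hne : x.val ≠ c.val := fun hxc => hxa (Fin.ext hxc ▸ hca)
    exact ⟨c, by omega, hca⟩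

lemma isLeftMax_iff (hx : ¬ LeftNbrGE σ (x.val + 1) x) :
    IsLeftMax σ x ↔ descentBottomsBefore σ x = ∅ := by
  simp only [eq_empty_iff_forall_notMem, descentBottomsBefore, mem_filter, mem_univ, true_and,
    mem_smallerAfter]
  constructor
  · rintro hmax a ⟨hax, hxa, c, hxc, hca⟩
    have := hmax c (by grind)
    omega
  · intro hbefore
    suffices hlt : ∀ k c, (σ.symm c).val + k + 1 = (σ.symm x).val → c < x from
      fun c hc => hlt ((σ.symm x).val - (σ.symm c).val - 1) c (by omega)
    intro k
    induction k with
    | zero =>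
      intro c hc
      by_contra! hxc
      have hne : c ≠ x := by grind
      exact hx ⟨c, by omega, hc⟩
    | succ k ih =>
      intro c hc
      by_contra! hxc
      have hne : c ≠ x := by grind
      obtain ⟨d, hd⟩ : ∃ d, (σ.symm d).val = (σ.symm c).val + 1 :=
        ⟨σ ⟨(σ.symm c).val + 1, by omega⟩, by simp⟩
      exact hbefore d ⟨ih d (by omega), by omega, c, by omega, hd.symm⟩

/-- A pair `(r, T)` records the shape that the letters below `m` have in a word: `r` is the order
in which they occur, and `T` is the set of the `h` letters among them that start a block, i.e. are
immediately preceded by a letter that is at least `m`. -/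
structure IsBlockOrder (m h : ℕ) (s : Finset (Fin n × Fin n) × Finset (Fin n)) : Prop where
  lt : ∀ a b, (a, b) ∈ s.1 → a.val < m ∧ b.val < m
  strict : IsStrictOrder (Fin n) fun a b => (a, b) ∈ s.1
  chain : IsChain (fun a b => (a, b) ∈ s.1) {a : Fin n | a.val < m}
  lt_of_mem : ∀ a ∈ s.2, a.val < m
  card_eq : #s.2 = h

/-- The permutations in whose word the letters below `m` have the shape `(r, T)`. -/
def blockClass (m : ℕ) (s : Finset (Fin n × Fin n) × Finset (Fin n)) :
    Finset (Equiv.Perm (Fin n)) :=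
  {σ | (∀ a b : Fin n, a.val < m → b.val < m → (σ.symm a < σ.symm b ↔ (a, b) ∈ s.1)) ∧
    ∀ a : Fin n, a.val < m → (a ∈ s.2 ↔ LeftNbrGE σ m a)}

lemma mem_blockClass {s : Finset (Fin n × Fin n) × Finset (Fin n)} : σ ∈ blockClass m s ↔
    (∀ a b : Fin n, a.val < m → b.val < m → (σ.symm a < σ.symm b ↔ (a, b) ∈ s.1)) ∧
      ∀ a : Fin n, a.val < m → (a ∈ s.2 ↔ LeftNbrGE σ m a) := by
  simp [blockClass]

lemma IsBlockOrder.isChain (hs : IsBlockOrder m h (r, T)) :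
    IsChain (fun a b => (a, b) ∈ r) (T : Set (Fin n)) :=
  hs.chain.mono hs.lt_of_mem

lemma card_blockClass {s : Finset (Fin n × Fin n) × Finset (Fin n)} (hs : IsBlockOrder n h s) :
    #(blockClass n s) = if h = 0 then 1 else 0 := by
  have hnbr (σ : Equiv.Perm (Fin n)) a : ¬ LeftNbrGE σ n a := fun ⟨c, hc, _⟩ => by omega
  split_ifs with h0
  · have hT : s.2 = ∅ := card_eq_zero.1 (hs.card_eq.trans h0)
    have := hs.strict
    have : IsStrictTotalOrder (Fin n) fun a b => (a, b) ∈ s.1 :=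
      { trichotomous := fun a b hab hba => by_contra fun hne =>
          (hs.chain a.isLt b.isLt hne).elim hab hba }
    obtain ⟨e, he, hunique⟩ :=
      existsUnique_equiv_fin (fun a b : Fin n => (a, b) ∈ s.1) (Fintype.card_fin n)
    refine card_eq_one.2 ⟨e.symm, ext fun σ => ?_⟩
    rw [mem_blockClass, mem_singleton]
    refine ⟨fun hσ => ?_, ?_⟩
    · rw [← hunique σ.symm fun a b => hσ.1 a b a.isLt b.isLt, Equiv.symm_symm]
    · rintro rfl
      simp [he, hT, hnbr]
  · obtain ⟨a, ha⟩ := card_pos.1 (Nat.pos_of_ne_zero (hs.card_eq ▸ h0))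
    refine card_eq_zero.2 (eq_empty_iff_forall_notMem.2 fun σ hσ => ?_)
    exact hnbr σ a (((mem_blockClass.1 hσ).2 a a.isLt).1 ha)

end BlockClass

section InsertOrder

variable {n h : ℕ} {σ : Equiv.Perm (Fin n)} {x y a b : Fin n} {r : Finset (Fin n × Fin n)}
  {T T' U : Finset (Fin n)}

/-- The up-set generated by the letter `y` in the order `r`. -/
def upSet (r : Finset (Fin n × Fin n)) (y : Fin n) : Finset (Fin n) := {b | b = y ∨ (y, b) ∈ r}

lemma mem_upSet : b ∈ upSet r y ↔ b = y ∨ (y, b) ∈ r := by simp [upSet]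

/-- The possible sets of letters to the right of a new largest letter: it can be inserted just
before the start of a block, or at the end. -/
def cuts (r : Finset (Fin n × Fin n)) (T : Finset (Fin n)) : Finset (Finset (Fin n)) :=
  insert ∅ (T.image (upSet r))

lemma mem_cuts : U ∈ cuts r T ↔ U = ∅ ∨ ∃ y ∈ T, U = upSet r y := by
  simp [cuts, eq_comm]

lemma sum_cuts {M : Type*} [AddCommMonoid M] (hs : IsBlockOrder x h (r, T))
    (F : Finset (Fin n) → M) : ∑ U ∈ cuts r T, F U = ∑ y ∈ T, F (upSet r y) + F ∅ := by
  have := hs.strict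
  rw [cuts, sum_insert, sum_image, add_comm]
  · intro y _ z _ hyz
    by_contra hne
    have hy' : y ∈ upSet r z := hyz ▸ mem_upSet.2 (.inl rfl)
    have hz' : z ∈ upSet r y := hyz ▸ mem_upSet.2 (.inl rfl)
    have hasymm := asymm_of (fun a b => (a, b) ∈ r) (a := y) (b := z)
    simp only [mem_upSet] at hy' hz'
    grind
  · simp only [mem_image, not_exists, not_and]
    exact fun y _ => ne_empty_of_mem (mem_upSet.2 (.inl rfl))

/-- The order `r` with a new letter `x` inserted just to the left of the letters of `U`. -/
def insertOrder (r : Finset (Fin n × Fin n)) (x : Fin n) (U : Finset (Fin n)) :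
    Finset (Fin n × Fin n) :=
  {ab | ab ∈ r ∨ (ab.2 = x ∧ ab.1 < x ∧ ab.1 ∉ U) ∨ (ab.1 = x ∧ ab.2 ∈ U)}

lemma mem_insertOrder :
    (a, b) ∈ insertOrder r x U ↔ (a, b) ∈ r ∨ (b = x ∧ a < x ∧ a ∉ U) ∨ (a = x ∧ b ∈ U) := by
  simp [insertOrder]

lemma leftNbrGE_of_forall_le (hy : y ∈ smallerAfter σ x)
    (hmin : ∀ b ∈ smallerAfter σ x, σ.symm y ≤ σ.symm b) : LeftNbrGE σ x y := by
  simp only [mem_smallerAfter] at hy hmin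
  obtain ⟨c, hc⟩ : ∃ c, (σ.symm c).val + 1 = (σ.symm y).val :=
    ⟨σ ⟨(σ.symm y).val - 1, by omega⟩, by simp; omega⟩
  refine ⟨c, ?_, hc⟩
  by_contra! hcx
  have hne : σ.symm c ≠ σ.symm x := fun hcx' => by simp [σ.symm.injective hcx'] at hcx
  have := hmin c
  grind

namespace IsBlockOrder

variable (hs : IsBlockOrder x h (r, T))

include hs

lemma lt_of_mem_cuts (hU : U ∈ cuts r T) (hb : b ∈ U) : b < x := by
  obtain rfl | ⟨y, hy, rfl⟩ := mem_cuts.1 hU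
  · simp at hb
  · obtain rfl | hyb := mem_upSet.1 hb
    · exact hs.lt_of_mem _ hy
    · exact (hs.lt y b hyb).2

lemma mem_of_mem_cuts (hU : U ∈ cuts r T) (ha : a ∈ U) (hab : (a, b) ∈ r) : b ∈ U := by
  have := hs.strict
  obtain rfl | ⟨y, hy, rfl⟩ := mem_cuts.1 hU
  · simp at ha
  · rw [mem_upSet] at ha ⊢
    rcases ha with rfl | hya
    · exact .inr hab
    · exact .inr (trans_of (fun a b => (a, b) ∈ r) hya hab)

lemma insert_of_mem_cuts (hU : U ∈ cuts r T) (hT' : T'.erase x ⊆ T) :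
    IsBlockOrder (x + 1) #T' (insertOrder r x U, T') where
  lt a b hab := by
    have := hs.lt a b
    have := hs.lt_of_mem_cuts hU (b := b)
    rw [mem_insertOrder] at hab
    grind
  strict :=
    { irrefl a := by
        have := hs.strict
        have := irrefl_of (fun a b => (a, b) ∈ r) a
        have := hs.lt_of_mem_cuts hU (b := a)
        simp only [mem_insertOrder]
        grind
      trans a b c := by
        have := hs.strict
        have := trans_of (fun a b => (a, b) ∈ r) (a := a) (b := b) (c := c)
        have := hs.lt a b
        have := hs.lt b c
        have := hs.mem_of_mem_cuts hU (a := a) (b := b)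
        have := hs.mem_of_mem_cuts hU (a := b) (b := c)
        have := hs.mem_of_mem_cuts hU (a := c) (b := a)
        have := hs.lt_of_mem_cuts hU (b := b)
        have := hs.lt_of_mem_cuts hU (b := c)
        have htot : a < x → c < x → a ≠ c → (a, c) ∈ r ∨ (c, a) ∈ r := fun ha hc => hs.chain ha hc
        simp only [mem_insertOrder]
        grind }
  chain a ha b hb hab := by
    have htot : a < x → b < x → (a, b) ∈ r ∨ (b, a) ∈ r := fun ha hb => hs.chain ha hb hab
    simp only [mem_insertOrder]
    simp only [Set.mem_ofPred_eq] at ha hb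
    grind
  lt_of_mem a ha := by
    by_contra hax
    have := hs.lt_of_mem a (hT' (mem_erase.2 ⟨by grind, ha⟩))
    grind
  card_eq := rfl

lemma smallerAfter_mem_cuts (hσ : σ ∈ blockClass x (r, T)) : smallerAfter σ x ∈ cuts r T := by
  obtain hempty | hne := (smallerAfter σ x).eq_empty_or_nonempty
  · exact mem_cuts.2 (.inl hempty)
  obtain ⟨y, hy, hmin⟩ := exists_min_image _ σ.symm hne
  rw [mem_blockClass] at hσ
  have hyx := (mem_smallerAfter.1 hy).1
  refine mem_cuts.2 (.inr ⟨y, (hσ.2 y hyx).2 (leftNbrGE_of_forall_le hy hmin), ext fun b => ?_⟩)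
  have hlt := hs.lt y b
  have hyb := hσ.1 y b hyx
  have hinj : σ.symm y = σ.symm b → y = b := fun h => σ.symm.injective h
  have := hmin b
  rw [mem_smallerAfter] at hy this ⊢
  rw [mem_upSet]
  grind

lemma mem_blockClass_insertOrder (hU : U ∈ cuts r T) :
    σ ∈ blockClass (x + 1) (insertOrder r x U, T') ↔
      (∀ a < x, ∀ b < x, (σ.symm a < σ.symm b ↔ (a, b) ∈ r)) ∧
      smallerAfter σ x = U ∧
      (∀ a < x, (a ∈ T' ↔ LeftNbrGE σ (x + 1) a)) ∧
      (x ∈ T' ↔ LeftNbrGE σ (x + 1) x) := by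
  have hle (a : Fin n) : a.val < x.val + 1 ↔ a < x ∨ a = x := by grind
  have hxr (a) : (x, a) ∉ r ∧ (a, x) ∉ r :=
    ⟨fun h => (hs.lt _ _ h).1.false, fun h => (hs.lt _ _ h).2.false⟩
  have hUx (a) := hs.lt_of_mem_cuts hU (b := a)
  have hinj (a) : σ.symm a = σ.symm x → a = x := fun h => σ.symm.injective h
  simp only [mem_blockClass, hle, mem_insertOrder, Finset.ext_iff, mem_smallerAfter]
  grind

end IsBlockOrder

end InsertOrder

section LinearSum

variable {n h : ℕ} {σ : Equiv.Perm (Fin n)} {x y a : Fin n} {r : Finset (Fin n × Fin n)}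
  {T T' U : Finset (Fin n)}

lemma leftNbrGE_succ_of_not_rightNbrLT (hright : ¬ RightNbrLT σ x) (hax : a < x) :
    LeftNbrGE σ (x + 1) a ↔ LeftNbrGE σ x a :=
  leftNbrGE_succ_iff.trans (and_iff_left fun hxa => hright ⟨a, hax, hxa⟩)

lemma eq_of_adjacent (hord : ∀ a < x, ∀ b < x, (σ.symm a < σ.symm b ↔ (a, b) ∈ r))
    (hU : smallerAfter σ x = upSet r y) (hax : a < x) (hadj : (σ.symm x).val + 1 = σ.symm a) :
    a = y := by
  have hy : y ∈ smallerAfter σ x := hU ▸ mem_upSet.2 (.inl rfl)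
  have ha : a ∈ upSet r y := hU ▸ mem_smallerAfter.2 ⟨hax, by omega⟩
  rw [mem_smallerAfter] at hy
  refine (mem_upSet.1 ha).resolve_right fun hya => ?_
  have := (hord y hy.1 a hax).2 hya
  omega

lemma leftNbrGE_of_smallerAfter_eq_upSet
    (hord : ∀ a < x, ∀ b < x, (σ.symm a < σ.symm b ↔ (a, b) ∈ r))
    (hU : smallerAfter σ x = upSet r y) : LeftNbrGE σ x y := by
  have hy : y ∈ smallerAfter σ x := hU ▸ mem_upSet.2 (.inl rfl)
  refine leftNbrGE_of_forall_le hy fun b hb => ?_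
  obtain rfl | hyb := mem_upSet.1 (hU ▸ hb)
  · exact le_rfl
  · exact ((hord y (mem_smallerAfter.1 hy).1 b (mem_smallerAfter.1 hb).1).2 hyb).le

lemma rightNbrLT_iff (hord : ∀ a < x, ∀ b < x, (σ.symm a < σ.symm b ↔ (a, b) ∈ r))
    (hU : smallerAfter σ x = upSet r y) : RightNbrLT σ x ↔ ¬ LeftNbrGE σ (x + 1) y := by
  have hyx : y < x := (mem_smallerAfter.1 (hU ▸ mem_upSet.2 (.inl rfl))).1
  rw [leftNbrGE_succ_iff, and_iff_right (leftNbrGE_of_smallerAfter_eq_upSet hord hU), not_not]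
  exact ⟨fun ⟨a, hax, hadj⟩ => eq_of_adjacent hord hU hax hadj ▸ hadj, fun hadj => ⟨y, hyx, hadj⟩⟩

lemma not_rightNbrLT_of_smallerAfter_eq_empty (hU : smallerAfter σ x = ∅) :
    ¬ RightNbrLT σ x := by
  rintro ⟨a, hax, hadj⟩
  exact notMem_empty a (hU ▸ mem_smallerAfter.2 ⟨hax, by omega⟩)

namespace IsBlockOrder

variable (hs : IsBlockOrder x h (r, T))

include hs

lemma filter_blockClass_of_not_rightNbrLT (hU : U ∈ cuts r T) (hT' : T'.erase x = T) :
    {σ ∈ blockClass x (r, T) | smallerAfter σ x = U ∧ ¬ RightNbrLT σ x ∧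
      (LeftNbrGE σ (x + 1) x ↔ x ∈ T')} = blockClass (x + 1) (insertOrder r x U, T') := by
  ext σ
  rw [mem_filter, hs.mem_blockClass_insertOrder hU, mem_blockClass]
  have hmem (a) (hax : a < x) : a ∈ T' ↔ a ∈ T := by grind
  have hnbr (a) := leftNbrGE_succ_of_not_rightNbrLT (σ := σ) (x := x) (a := a)
  have hright : (∀ a < x, ∀ b < x, (σ.symm a < σ.symm b ↔ (a, b) ∈ r)) → smallerAfter σ x = U →
      (∀ a < x, (a ∈ T ↔ LeftNbrGE σ (x + 1) a)) → ¬ RightNbrLT σ x := by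
    intro hord hσU hT
    obtain rfl | ⟨y, hy, rfl⟩ := mem_cuts.1 hU
    · exact not_rightNbrLT_of_smallerAfter_eq_empty hσU
    · rw [rightNbrLT_iff hord hσU, not_not]
      exact (hT y (hs.lt_of_mem y hy)).1 hy
  grind

lemma filter_blockClass_of_rightNbrLT (hy : y ∈ T) (hT' : T'.erase x = T.erase y) :
    {σ ∈ blockClass x (r, T) | smallerAfter σ x = upSet r y ∧ RightNbrLT σ x ∧
      (LeftNbrGE σ (x + 1) x ↔ x ∈ T')} =
      blockClass (x + 1) (insertOrder r x (upSet r y), T') := by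
  ext σ
  rw [mem_filter, hs.mem_blockClass_insertOrder (mem_cuts.2 (.inr ⟨y, hy, rfl⟩)), mem_blockClass]
  have hmem (a) (hax : a < x) : a ∈ T' ↔ a ≠ y ∧ a ∈ T := by
    rw [← mem_erase, ← hT', mem_erase, and_iff_right hax.ne]
  have hyx : y < x := hs.lt_of_mem y hy
  have hblocks (hord : ∀ a < x, ∀ b < x, (σ.symm a < σ.symm b ↔ (a, b) ∈ r))
      (hU : smallerAfter σ x = upSet r y) :
      ((∀ a < x, (a ∈ T ↔ LeftNbrGE σ x a)) ∧ RightNbrLT σ x) ↔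
        ∀ a < x, (a ∈ T' ↔ LeftNbrGE σ (x + 1) a) := by
    have hleft := leftNbrGE_of_smallerAfter_eq_upSet hord hU
    have hnbr (a) (hax : a < x) (hay : a ≠ y) : LeftNbrGE σ (x + 1) a ↔ LeftNbrGE σ x a :=
      leftNbrGE_succ_iff.trans (and_iff_left fun hadj => hay (eq_of_adjacent hord hU hax hadj))
    rw [rightNbrLT_iff hord hU]
    grind
  grind

end IsBlockOrder

end LinearSum

section LinearSum

variable {n h : ℕ} {σ : Equiv.Perm (Fin n)} {x y : Fin n} {r : Finset (Fin n × Fin n)}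
  {T T' U : Finset (Fin n)} {R : Type*} [CommSemiring R]

lemma descentBottomsBefore_eq (hs : IsBlockOrder x h (r, T)) (hσ : σ ∈ blockClass x (r, T)) :
    descentBottomsBefore σ x = T \ smallerAfter σ x := by
  ext a
  have hT := hs.lt_of_mem a
  have hmem := (mem_blockClass.1 hσ).2 a
  have hnbr := leftNbrGE_succ_iff (σ := σ) (x := x) (a := a)
  simp only [descentBottomsBefore, mem_filter, mem_univ, true_and, mem_sdiff, mem_smallerAfter]
  grind

lemma descentBottomsAfter_of_not_rightNbrLT (hσ : σ ∈ blockClass x (r, T))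
    (hright : ¬ RightNbrLT σ x) : descentBottomsAfter σ x = T ∩ smallerAfter σ x := by
  ext a
  have hmem := (mem_blockClass.1 hσ).2 a
  have hnbr := leftNbrGE_succ_of_not_rightNbrLT (a := a) hright
  simp only [descentBottomsAfter, mem_filter, mem_inter, mem_smallerAfter]
  grind

lemma descentBottomsAfter_of_rightNbrLT (hσ : σ ∈ blockClass x (r, T))
    (hU : smallerAfter σ x = upSet r y) (hright : RightNbrLT σ x) :
    descentBottomsAfter σ x = (T ∩ upSet r y).erase y := by
  have hord (a) (hax : a < x) (b) (hbx : b < x) := (mem_blockClass.1 hσ).1 a b hax hbx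
  have hyright := (rightNbrLT_iff hord hU).1 hright
  rw [← hU]
  ext a
  have hmem := (mem_blockClass.1 hσ).2 a
  have hnbr (hax : a < x) (hay : a ≠ y) : LeftNbrGE σ (x + 1) a ↔ LeftNbrGE σ x a :=
    leftNbrGE_succ_iff.trans (and_iff_left fun hadj => hay (eq_of_adjacent hord hU hax hadj))
  simp only [descentBottomsAfter, mem_filter, mem_erase, mem_inter, mem_smallerAfter]
  grind

/-- The contribution of the letter `x` to the linear weight of `σ`: a valley `x` contributes `w`, a
foremaximum `y`, and a double ascent that is not a foremaximum `0`. -/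
def linWt (p q w y : R) (σ : Equiv.Perm (Fin n)) (x : Fin n) : R :=
  q ^ #(descentBottomsBefore σ x) * p ^ #(descentBottomsAfter σ x) *
    if RightNbrLT σ x then 1
    else if LeftNbrGE σ (x + 1) x then w
    else if IsLeftMax σ x then y else 0

lemma linWt_of_rightNbrLT (p q w z : R) (hs : IsBlockOrder x h (r, T)) (hy : y ∈ T)
    (hσ : σ ∈ blockClass x (r, T)) (hU : smallerAfter σ x = upSet r y) (hright : RightNbrLT σ x) :
    linWt p q w z σ x = q ^ #{a ∈ T | (a, y) ∈ r} * p ^ #{a ∈ T | (y, a) ∈ r} := by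
  have := hs.strict
  have hirr := irrefl_of (fun a b => (a, b) ∈ r) y
  have hasymm (a) := asymm_of (fun a b => (a, b) ∈ r) (a := a) (b := y)
  have htot (a) (ha : a ∈ T) : a ≠ y → _ := hs.isChain ha hy
  rw [linWt, if_pos hright, mul_one, descentBottomsBefore_eq hs hσ, hU,
    descentBottomsAfter_of_rightNbrLT hσ hU hright]
  congr 3 <;> ext a <;> simp only [mem_sdiff, mem_erase, mem_inter, mem_filter, mem_upSet] <;> grind

lemma linWt_of_not_rightNbrLT (p q w y : R) (hs : IsBlockOrder x h (r, T))
    (hσ : σ ∈ blockClass x (r, T)) (hU : smallerAfter σ x = U) (hright : ¬ RightNbrLT σ x) :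
    linWt p q w y σ x = q ^ #(T \ U) * p ^ (h - #(T \ U)) *
      if LeftNbrGE σ (x + 1) x then w else if #(T \ U) = 0 then y else 0 := by
  have hcard : #(T ∩ U) = h - #(T \ U) := by
    rw [← hs.card_eq, ← card_inter_add_card_sdiff T U, Nat.add_sub_cancel]
  have hmax (hleft : ¬ LeftNbrGE σ (x + 1) x) : IsLeftMax σ x ↔ #(T \ U) = 0 := by
    rw [isLeftMax_iff hleft, descentBottomsBefore_eq hs hσ, hU, card_eq_zero]
  rw [linWt, if_neg hright, descentBottomsAfter_of_not_rightNbrLT hσ hright,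
    descentBottomsBefore_eq hs hσ, hU, hcard]
  grind

lemma sum_cuts_card_sdiff {M : Type*} [AddCommMonoid M] (hs : IsBlockOrder x h (r, T))
    (f : ℕ → M) : ∑ U ∈ cuts r T, f #(T \ U) = ∑ i ∈ range (h + 1), f i := by
  have := hs.strict
  rw [sum_cuts hs, sum_range_succ, ← hs.card_eq, ← sum_card_pred hs.isChain, sdiff_empty]
  congr 1
  refine sum_congr rfl fun y hy => ?_
  have hirr := irrefl_of (fun a b => (a, b) ∈ r) y
  have hasymm (a) := asymm_of (fun a b => (a, b) ∈ r) (a := a) (b := y)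
  have htot (a) (ha : a ∈ T) : a ≠ y → _ := hs.isChain ha hy
  congr 2
  ext a
  simp only [mem_sdiff, mem_filter, mem_upSet]
  grind

namespace IsBlockOrder

variable (hs : IsBlockOrder x h (r, T)) {F : Equiv.Perm (Fin n) → R} {c : ℕ → R}
  (hF : ∀ h' s', IsBlockOrder (x + 1) h' s' → ∑ σ ∈ blockClass (x + 1) s', F σ = c h')

include hs hF

lemma sum_of_not_rightNbrLT (p q w y : R) (hT' : T'.erase x = T) :
    ∑ σ ∈ blockClass x (r, T) with ¬ RightNbrLT σ x ∧ (LeftNbrGE σ (x + 1) x ↔ x ∈ T'),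
      linWt p q w y σ x * F σ =
    (∑ i ∈ range (h + 1), q ^ i * p ^ (h - i) *
      if x ∈ T' then w else if i = 0 then y else 0) * c #T' := by
  rw [← sum_cuts_card_sdiff hs, sum_mul, ← sum_fiberwise_of_maps_to (t := cuts r T)
    (g := fun σ => smallerAfter σ x) fun σ hσ => hs.smallerAfter_mem_cuts (mem_filter.1 hσ).1]
  refine sum_congr rfl fun U hU => ?_
  rw [← hF _ _ (hs.insert_of_mem_cuts hU (T' := T') hT'.le),
    ← hs.filter_blockClass_of_not_rightNbrLT hU hT', mul_sum, filter_filter]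
  refine sum_congr (filter_congr fun σ _ => by tauto) fun σ hσ => ?_
  obtain ⟨hσ, hσU, hright, hleft⟩ := mem_filter.1 hσ
  simp only [linWt_of_not_rightNbrLT p q w y hs hσ hσU hright, hleft]

lemma sum_of_rightNbrLT (p q w y : R) (hT' : T'.erase x = T) :
    ∑ σ ∈ blockClass x (r, T) with RightNbrLT σ x ∧ (LeftNbrGE σ (x + 1) x ↔ x ∈ T'),
      linWt p q w y σ x * F σ = pqNat p q h * c (#T' - 1) := by
  have := hs.strict
  rw [← hs.card_eq, ← sum_pow_card_pred_mul_pow_card_succ hs.isChain, sum_mul,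
    ← sum_fiberwise_of_maps_to (t := cuts r T) (g := fun σ => smallerAfter σ x)
      fun σ hσ => hs.smallerAfter_mem_cuts (mem_filter.1 hσ).1, sum_cuts hs]
  rw [sum_eq_zero (s := filter _ _), add_zero]
  · refine sum_congr rfl fun z hz => ?_
    have hxz : x ≠ z := ne_of_gt (hs.lt_of_mem z hz)
    have herase : (T'.erase z).erase x = T.erase z := by rw [erase_right_comm, hT']
    have hzT' : z ∈ T' := mem_of_mem_erase (hT' ▸ hz)
    rw [← card_erase_of_mem hzT', ← hF _ _ (hs.insert_of_mem_cuts (mem_cuts.2 (.inr ⟨z, hz, rfl⟩))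
      (herase.trans_subset (erase_subset z T))), ← hs.filter_blockClass_of_rightNbrLT hz herase,
      mul_sum, filter_filter]
    simp only [mem_erase, ne_eq, hxz, not_false_iff, true_and]
    refine sum_congr (filter_congr fun σ _ => by tauto) fun σ hσ => ?_
    obtain ⟨hσ, hσU, hright, -⟩ := mem_filter.1 hσ
    rw [linWt_of_rightNbrLT p q w y hs hz hσ hσU hright]
  · intro σ hσ
    simp only [mem_filter] at hσ
    exact absurd hσ.1.2.1 (not_rightNbrLT_of_smallerAfter_eq_empty hσ.2)

lemma sum_blockClass_of_leftNbrGE_iff (p q w y : R) (hT' : T'.erase x = T) :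
    ∑ σ ∈ blockClass x (r, T) with (LeftNbrGE σ (x + 1) x ↔ x ∈ T'), linWt p q w y σ x * F σ =
      (∑ i ∈ range (h + 1), q ^ i * p ^ (h - i) *
        if x ∈ T' then w else if i = 0 then y else 0) * c #T' + pqNat p q h * c (#T' - 1) := by
  rw [← hs.sum_of_not_rightNbrLT hF p q w y hT', ← hs.sum_of_rightNbrLT hF p q w y hT',
    ← sum_filter_add_sum_filter_not _ fun σ => ¬ RightNbrLT σ x, filter_filter, filter_filter]
  simp only [not_not, and_comm]

lemma sum_blockClass (p q w y : R) :
    ∑ σ ∈ blockClass x (r, T), linWt p q w y σ x * F σ =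
      motzkinStep (fun i => w * pqNat p q (i + 1)) (fun i => pqNat p q i + y * p ^ i)
        (fun i => pqNat p q i) c h := by
  have hxT : x ∉ T := fun hx => (hs.lt_of_mem x hx).false
  have hin := hs.sum_blockClass_of_leftNbrGE_iff hF p q w y (T' := insert x T) (by simp [hxT])
  have hout := hs.sum_blockClass_of_leftNbrGE_iff hF p q w y (T' := T) (by simp [hxT])
  simp only [mem_insert_self, if_true, iff_true, card_insert_of_notMem hxT, hs.card_eq,
    Nat.add_sub_cancel, ← sum_mul] at hin
  simp only [hxT, if_false, iff_false, hs.card_eq, mul_ite, mul_zero, sum_ite_eq', mem_range,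
    Nat.succ_pos, if_true, pow_zero, one_mul, Nat.sub_zero] at hout
  rw [← sum_filter_add_sum_filter_not _ fun σ => LeftNbrGE σ (x + 1) x, hin, hout,
    motzkinStep_eq (by simp [pqNat])]
  simp only [pqNat, Nat.add_sub_cancel]
  ring

end IsBlockOrder

lemma isBlockOrder_zero :
    IsBlockOrder 0 0 ((∅, ∅) : Finset (Fin n × Fin n) × Finset (Fin n)) where
  lt _ _ hab := absurd hab (notMem_empty _)
  strict :=
    { irrefl := fun _ => notMem_empty _, trans := fun _ _ _ hab => absurd hab (notMem_empty _) }
  chain a ha := absurd ha (Nat.not_lt_zero a)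
  lt_of_mem a ha := absurd ha (notMem_empty a)
  card_eq := card_empty

theorem sum_prod_linWt (p q w y : R) :
    ∑ σ : Equiv.Perm (Fin n), ∏ x, linWt p q w y σ x =
      motzkinSum (fun i => w * pqNat p q (i + 1)) (fun i => pqNat p q i + y * p ^ i)
        (fun i => pqNat p q i) n 0 := by
  rw [← sum_prod_eq_motzkinSum (linWt p q w y) (fun m h s => IsBlockOrder m h s) blockClass
    (fun h s => card_blockClass) (fun x h s hs F c hF => hs.sum_blockClass hF p q w y)
    (Nat.zero_add n) isBlockOrder_zero]
  simp [blockClass]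

end LinearSum

section Word

variable {n : ℕ} (σ : Equiv.Perm (Fin n))

/-- The one-based position of a letter in the word of `σ`. -/
def pos : Fin n ↪ ℕ where
  toFun x := (σ.symm x).val + 1
  inj' := (add_left_injective 1).comp (Fin.val_injective.comp σ.symm.injective)

lemma pos_eq (x : Fin n) : pos σ x = (σ.symm x).val + 1 := rfl

lemma Icc_eq_map_pos : Icc 1 n = univ.map (pos σ) := by
  ext i
  simp only [mem_Icc, mem_map, mem_univ, true_and, pos_eq]
  refine ⟨fun hi => ⟨σ ⟨i - 1, by omega⟩, ?_⟩, fun ⟨x, hx⟩ => by omega⟩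
  simp [Nat.sub_add_cancel hi.1]

lemma word_of_eq_pos {i : ℕ} {x : Fin n} (hi : i = pos σ x) : word σ i = x.val + 1 := by
  simp [hi, word, pos_eq]

lemma lt_word_pos_pred_iff (k : ℕ) (x : Fin n) :
    k + 1 < word σ (pos σ x - 1) ↔ LeftNbrGE σ (k + 1) x := by
  rw [pos_eq, Nat.add_sub_cancel]
  constructor
  · intro hk
    have hx : (σ.symm x).val ≠ 0 := fun hx => by simp [word, hx] at hk
    refine ⟨σ ⟨(σ.symm x).val - 1, by omega⟩, ?_, by simp; omega⟩
    rw [word, dif_pos ⟨by omega, by omega⟩] at hk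
    omega
  · rintro ⟨c, hkc, hcx⟩
    rw [word_of_eq_pos σ hcx.symm]
    omega

lemma word_pos_succ_lt_iff (x : Fin n) :
    word σ (pos σ x + 1) < x.val + 1 ↔ RightNbrLT σ x := by
  rw [pos_eq]
  constructor
  · intro hx
    have hlt : (σ.symm x).val + 1 < n := by
      by_contra hge
      rw [word, dif_neg (by omega)] at hx
      omega
    refine ⟨σ ⟨(σ.symm x).val + 1, hlt⟩, ?_, by simp⟩
    rw [word, dif_pos ⟨by omega, by omega⟩] at hx
    exact Nat.lt_of_succ_lt_succ hx
  · rintro ⟨c, hcx, hxc⟩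
    rw [hxc, word_of_eq_pos σ (pos_eq σ c).symm]
    exact Nat.succ_lt_succ hcx

lemma word_ne_of_ne_pos {i : ℕ} {x : Fin n} (hi : i ≠ pos σ x) :
    word σ i ≠ x.val + 1 := by
  intro hword
  rw [word] at hword
  split_ifs at hword with h
  · refine hi ?_
    rw [← (Fin.ext (Nat.succ_injective hword) : σ ⟨i - 1, _⟩ = x), pos_eq, Equiv.symm_apply_apply]
    exact (Nat.sub_add_cancel h.1).symm
  · omega

lemma lt_word_pos_succ_iff (x : Fin n) :
    x.val + 1 < word σ (pos σ x + 1) ↔ ¬ RightNbrLT σ x := by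
  have hne : word σ (pos σ x + 1) ≠ x.val + 1 :=
    word_ne_of_ne_pos σ (by omega)
  rw [← word_pos_succ_lt_iff]
  omega

lemma word_pos_pred_lt_iff (x : Fin n) :
    word σ (pos σ x - 1) < x.val + 1 ↔ ¬ LeftNbrGE σ (x + 1) x := by
  have hne : word σ (pos σ x - 1) ≠ x.val + 1 :=
    word_ne_of_ne_pos σ (by rw [pos_eq]; omega)
  rw [← lt_word_pos_pred_iff]
  omega

lemma isValley_pos_iff (x : Fin n) :
    IsValley σ (pos σ x) ↔ LeftNbrGE σ (x + 1) x ∧ ¬ RightNbrLT σ x := by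
  rw [IsValley, word_of_eq_pos σ rfl, gt_iff_lt, lt_word_pos_pred_iff, lt_word_pos_succ_iff]

lemma isDoubleAscent_pos_iff (x : Fin n) :
    IsDoubleAscent σ (pos σ x) ↔ ¬ LeftNbrGE σ (x + 1) x ∧ ¬ RightNbrLT σ x := by
  rw [IsDoubleAscent, word_of_eq_pos σ rfl, word_pos_pred_lt_iff, lt_word_pos_succ_iff]

lemma isForemax_pos_iff (x : Fin n) :
    IsForemax σ (pos σ x) ↔ IsDoubleAscent σ (pos σ x) ∧ IsLeftMax σ x := by
  have hIco : Ico 1 (pos σ x) = {i ∈ Icc 1 n | i < pos σ x} := by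
    ext i
    have := (σ.symm x).isLt
    rw [mem_Ico, mem_filter, mem_Icc, pos_eq]
    omega
  rw [IsForemax, hIco, Icc_eq_map_pos σ, word_of_eq_pos σ rfl]
  simp only [mem_filter, mem_map, mem_univ, true_and, and_imp, forall_exists_index,
    forall_apply_eq_imp_iff, word_of_eq_pos σ rfl]
  simp only [pos_eq, Nat.add_lt_add_iff_right, Fin.val_fin_lt, IsLeftMax]

lemma valley_eq_card : valley σ = #{x : Fin n | LeftNbrGE σ (x + 1) x ∧ ¬ RightNbrLT σ x} := by
  simp only [valley, Icc_eq_map_pos σ, filter_map, card_map, Function.comp_def, isValley_pos_iff]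

lemma da_eq_card : da σ = #{x : Fin n | ¬ LeftNbrGE σ (x + 1) x ∧ ¬ RightNbrLT σ x} := by
  simp only [da, Icc_eq_map_pos σ, filter_map, card_map, Function.comp_def, isDoubleAscent_pos_iff]

lemma card_filter_Icc_product (P : ℕ → ℕ → Prop) [∀ i j, Decidable (P i j)] :
    #{ij ∈ Icc 1 n ×ˢ Icc 1 n | P ij.1 ij.2} = ∑ x, #{a | P (pos σ a) (pos σ x)} := by
  simp only [card_filter, sum_product_right, Icc_eq_map_pos σ, sum_map]

lemma pat31_2_eq_sum : pat31_2 σ = ∑ x, #(descentBottomsBefore σ x) := by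
  rw [pat31_2, card_filter_Icc_product σ fun i j => (2 ≤ i ∧ i < j) ∧
    word σ (i - 1) > word σ j ∧ word σ j > word σ i]
  refine sum_congr rfl fun x _ => congrArg card (filter_congr fun a _ => ?_)
  rw [word_of_eq_pos σ rfl, word_of_eq_pos σ rfl, gt_iff_lt, lt_word_pos_pred_iff,
    mem_smallerAfter, pos_eq, pos_eq]
  constructor
  · grind
  · rintro ⟨hax, hafter, c, hxc, hca⟩
    have hne : σ.symm a ≠ σ.symm x := σ.symm.injective.ne hax.ne
    exact ⟨by grind, ⟨c, hxc, hca⟩, by omega⟩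

/-- Here `31` is located by the position of its `1` rather than of its `3`, as in `pat31_2`. -/
lemma pat2_31_eq_card : pat2_31 σ = #{ij ∈ Icc 1 n ×ˢ Icc 1 n |
    ij.2 < ij.1 ∧ word σ ij.1 < word σ ij.2 ∧ word σ ij.2 < word σ (ij.1 - 1)} := by
  refine card_nbij' (fun ij => (ij.2 + 1, ij.1)) (fun ij => (ij.2, ij.1 - 1)) ?_ ?_ ?_ ?_
  · grind [Set.MapsTo]
  · grind [Set.MapsTo]
  · grind [Set.LeftInvOn]
  · grind [Set.LeftInvOn]

lemma pat2_31_eq_sum : pat2_31 σ = ∑ x, #(descentBottomsAfter σ x) := by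
  rw [pat2_31_eq_card, card_filter_Icc_product σ fun i j => j < i ∧
    word σ i < word σ j ∧ word σ j < word σ (i - 1)]
  refine sum_congr rfl fun x _ => congrArg card (ext fun a => ?_)
  simp only [descentBottomsAfter, mem_filter, mem_univ, true_and, mem_smallerAfter,
    word_of_eq_pos σ rfl, lt_word_pos_pred_iff]
  simp only [pos_eq]
  grind

/-- Every double ascent is a foremaximum. -/
def AllForemax : Prop :=
  ∀ i ∈ {i ∈ Icc 1 n | IsDoubleAscent σ i}, IsForemax σ i

instance : DecidablePred (AllForemax (n := n)) :=
  fun σ => by unfold AllForemax; infer_instance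

lemma allForemax_iff : AllForemax σ ↔
    ∀ x : Fin n, ¬ LeftNbrGE σ (x + 1) x → ¬ RightNbrLT σ x → IsLeftMax σ x := by
  simp only [AllForemax, Icc_eq_map_pos σ, mem_filter, mem_map, mem_univ, true_and, and_imp,
    forall_exists_index, forall_apply_eq_imp_iff, isForemax_pos_iff, isDoubleAscent_pos_iff]
  grind

lemma prod_linWt {R : Type*} [CommSemiring R] (p q w y : R) :
    ∏ x, linWt p q w y σ x = if AllForemax σ then
      p ^ pat2_31 σ * q ^ pat31_2 σ * w ^ valley σ * y ^ da σ else 0 := by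
  split_ifs with hfore
  · rw [allForemax_iff] at hfore
    have hwt (x : Fin n) : linWt p q w y σ x =
        p ^ #(descentBottomsAfter σ x) * q ^ #(descentBottomsBefore σ x) *
          (if LeftNbrGE σ (x + 1) x ∧ ¬ RightNbrLT σ x then w else 1) *
          (if ¬ LeftNbrGE σ (x + 1) x ∧ ¬ RightNbrLT σ x then y else 1) := by
      have := hfore x
      rw [linWt, mul_comm (q ^ _)]
      split_ifs <;> simp_all
    simp only [hwt, prod_mul_distrib, prod_pow_eq_pow_sum, prod_ite, prod_const, one_pow, mul_one,
      pat2_31_eq_sum, pat31_2_eq_sum, valley_eq_card, da_eq_card]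
  · rw [allForemax_iff] at hfore
    push Not at hfore
    obtain ⟨x, hleft, hright, hmax⟩ := hfore
    refine prod_eq_zero (mem_univ x) ?_
    rw [linWt, if_neg hright, if_neg hleft, if_neg hmax, mul_zero]

end Word

section Coefficients

open Polynomial

theorem B_eq_sum_allForemax {R : Type*} [CommSemiring R] (n : ℕ) (p q w y : R) :
    B n p q 1 0 1 w y = ∑ σ : Equiv.Perm (Fin n) with AllForemax σ,
      p ^ pat2_31 σ * q ^ pat31_2 σ * w ^ valley σ * y ^ da σ := by
  have hpaths := motzkinSum_mul_down (fun _ => w) (fun i => pqNat p q i + y * p ^ i)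
    (pqNat p q) (pqNat p q) n 0
  simp only [← sq, range_zero, prod_empty, one_mul] at hpaths
  rw [B_eq_motzkinSum, hpaths, ← sum_prod_linWt, sum_filter]
  exact sum_congr rfl fun σ _ => prod_linWt σ p q w y

theorem B_eq_sum_cda_eq_zero {R : Type*} [CommSemiring R] (n : ℕ) (p q w y : R) :
    B n p q 1 0 1 w y = ∑ σ : Equiv.Perm (Fin n) with cda σ = 0,
      p ^ nest σ * q ^ cros σ * w ^ cvalley σ * y ^ fix σ := by
  simp only [B, one_pow, mul_one, zero_pow_eq, mul_ite, mul_zero, ite_mul, zero_mul, sum_filter]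

lemma coeff_coeff_sum {ι R : Type*} [CommSemiring R] (s : Finset ι) (f : ι → R) (c d : ι → ℕ)
    (k j : ℕ) :
    ((∑ i ∈ s, (C (C (f i) * X ^ c i) * X ^ d i : R[X][X])).coeff j).coeff k =
      ∑ i ∈ s with c i = k ∧ d i = j, f i := by
  simp only [finsetSum_coeff, sum_filter]
  refine sum_congr rfl fun i _ => ?_
  rw [coeff_C_mul_X_pow, apply_ite (coeff · k), coeff_C_mul_X_pow, coeff_zero]
  grind

lemma b_eq_sum_S (n k j : ℕ) :
    b n k j = ∑ σ ∈ S n k j, pVar ^ nest σ * qVar ^ cros σ := by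
  rw [b, B_eq_sum_cda_eq_zero]
  simp only [← C_pow, ← C_mul, coeff_coeff_sum, filter_filter]
  exact sum_congr (filter_congr fun σ _ => by tauto) fun σ _ => rfl

lemma b_eq_sum_SStar (n k j : ℕ) :
    b n k j = ∑ σ ∈ SStar n k j, pVar ^ pat2_31 σ * qVar ^ pat31_2 σ := by
  rw [b, B_eq_sum_allForemax]
  simp only [← C_pow, ← C_mul, coeff_coeff_sum, filter_filter]
  exact sum_congr (filter_congr fun σ _ => by tauto) fun σ _ => rfl

lemma S_zero_eq_D (n k : ℕ) : S n k 0 = D n k := by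
  ext σ
  simp only [S, D, fix, mem_filter, mem_univ, true_and, card_eq_zero, filter_eq_empty_iff,
    forall_const]
  tauto

lemma SStar_zero_eq_DStar (n k : ℕ) : SStar n k 0 = DStar n k := by
  ext σ
  simp only [SStar, DStar, mem_filter, mem_univ, true_and]
  simp only [da, fmax, card_eq_zero, filter_eq_empty_iff]
  grind [IsForemax]

end Coefficients

end PermStat

theorem mainTheorem10 (n k : ℕ) :
    (∀ j : ℕ,
      PermStat.b n k j =
          ∑ σ ∈ PermStat.S n k j,
            PermStat.pVar ^ PermStat.nest σ * PermStat.qVar ^ PermStat.cros σ ∧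
        PermStat.b n k j =
          ∑ σ ∈ PermStat.SStar n k j,
            PermStat.pVar ^ PermStat.pat2_31 σ * PermStat.qVar ^ PermStat.pat31_2 σ) ∧
      PermStat.b n k 0 =
          ∑ σ ∈ PermStat.D n k,
            PermStat.pVar ^ PermStat.nest σ * PermStat.qVar ^ PermStat.cros σ ∧
      PermStat.b n k 0 =
          ∑ σ ∈ PermStat.DStar n k,
            PermStat.pVar ^ PermStat.pat2_31 σ * PermStat.qVar ^ PermStat.pat31_2 σ := by
  refine ⟨fun j => ⟨PermStat.b_eq_sum_S n k j, PermStat.b_eq_sum_SStar n k j⟩, ?_, ?_⟩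
  · rw [← PermStat.S_zero_eq_D, PermStat.b_eq_sum_S]
  · rw [← PermStat.SStar_zero_eq_DStar, PermStat.b_eq_sum_SStar]
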